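/- Let $E=(E^0,E^1,r,s)$ be a directed graph ($E^0$, $E^1$ countable; a vertex may emit infinitely many edges) and let $R$ be a commutative ring with $1$. A Leavitt $E$-family in an $R$-algebra consists of elements $v$, $e$, $e^*$ ($v\in E^0$, $e\in E^1$) such that the $v$ are pairwise orthogonal idempotents, $s(e)e=er(e)=e$, $r(e)e^*=e^*s(e)=e^*$, $e^*f=\delta_{e,f}\,r(e)$ for all $e,f\in E^1$, and $v=\sum_{s(e)=v}ee^*$ whenever $0<|s^{-1}(v)|<\infty$. The Leavitt path algebra $L_R(E)$ is the universal (not necessarily unital) $R$-algebra generated by a Leavitt $E$-family. A set $H\subseteq E^0$ is hereditary if $s(e)\in H$ implies $r(e)\in H$ for every edge $e$, and saturated if every $v\in E^0$ with $0<|s^{-1}(v)|<\infty$ and $r(s^{-1}(v))\subseteq H$ lies in $H$. For a saturated hereditary $H$ let $$B_H=\{v\in E^0\setminus H:\ |s^{-1}(v)|=\infty,\ 0<|s^{-1}(v)\cap r^{-1}(E^0\setminus H)|<\infty\},\qquad v^H=v-\sum_{s(e)=v,\ r(e)\notin H}ee^*\quad(v\in B_H).$$ An admissible pair $(H,S)$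 consists of a saturated hereditary set $H$ and a set $S\subseteq B_H$, and $I(H,S)$ is the two-sided ideal of $L_R(E)$ generated by $\{v:v\in H\}\cup\{v^H:v\in S\}$. For an admissible pair $(H,S)$ let $F_1(H,S)$ be the set of paths $e_1\cdots e_n$ in $E$ with $n\ge 1$, $s(e_n)\notin H\cup S$ and $r(e_n)\in H$, and let $F_2(H,S)$ be the set of paths $\alpha$ in $E$ of length $|\alpha|\ge 1$ with $r(\alpha)\in S$. Define the graph ${}_HE_S$ by $${}_HE_S^0=H\sqcup S\sqcup F_1(H,S)\sqcup F_2(H,S),$$ $${}_HE_S^1=s^{-1}(H)\sqcup\{e\in E^1:s(e)\in S,\ r(e)\in H\}\sqcup\{\overline\alpha:\alpha\in F_1(H,S)\}\sqcup\{\overline\alpha:\alpha\in F_2(H,S)\},$$ where $s(\overline\alpha)=\alpha$, $r(\overline\alpha)=r(\alpha)$, and the other edges keep their source and range from $E$. Then, for every admissible pair $(H,S)$ in $E$, $I(H,S)\cong L_R({}_HE_S)$ as rings. Moreover, $I(H,S)$ has a set of local units: there is a set $U\subseteq I(H,S)$ of commuting idempotents such that for every $x\in I(H,S)$ there is $u\in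 U$ with $ux=xu=x$. -/

import Mathlib

/-- A directed graph with vertex set `V`, edge set `W`, source map `s` and range map `r`. -/
structure DirGraph (V W : Type*) where
  s : W → V
  r : W → V

namespace DirGraph

variable {V W : Type*} (E : DirGraph V W)

/-! ### Leavitt families and Leavitt path algebras -/

/-- A Leavitt `E`-family in a (not necessarily unital) ring `A`: `a v`, `b e`, `c e` are the elements
written `v`, `e`, `e^*`. In `ck2` the finset `F` is the whole of `s⁻¹(v)`, so that the relation
is imposed exactly at the vertices with `0 < |s⁻¹(v)| < ∞`. -/
structure IsLeavittFamily {A : Type*} [NonUnitalRing A] (a : V → A) (b c : W → A) : Prop where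
  idem : ∀ v, a v * a v = a v
  orth : ∀ v w, v ≠ w → a v * a w = 0
  source_edge : ∀ e, a (E.s e) * b e = b e
  edge_range : ∀ e, b e * a (E.r e) = b e
  range_ghost : ∀ e, a (E.r e) * c e = c e
  ghost_source : ∀ e, c e * a (E.s e) = c e
  ck1_same : ∀ e, c e * b e = a (E.r e)
  ck1_ne : ∀ e f, e ≠ f → c e * b f = 0
  ck2 : ∀ (v : V) (F : Finset W), (∀ e, e ∈ F ↔ E.s e = v) → F.Nonempty →
    a v = ∑ e ∈ F, b e * c e

/-- The generating symbols: vertices, real edges and ghost edges. -/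
inductive Gen (V W : Type*) where
  | vertex : V → Gen V W
  | edge : W → Gen V W
  | ghost : W → Gen V W

/-- The free (associative, non-unital) `R`-algebra on the generating symbols. -/
abbrev FreeGen (R : Type*) (V W : Type*) [CommRing R] := MonoidAlgebra R (FreeSemigroup (Gen V W))

/-- A generating symbol as an element of the free algebra. -/
noncomputable def gen (R : Type*) [CommRing R] (x : Gen V W) : FreeGen R V W :=
  MonoidAlgebra.single (FreeSemigroup.of x) 1

open Gen in
/-- The defining relations of the Leavitt path algebra in the free algebra. -/
inductive LeavittRel (R : Type*) [CommRing R] : FreeGen R V W → FreeGen R V W → Prop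
  | idem (v : V) : LeavittRel R (gen R (vertex v) * gen R (vertex v)) (gen R (vertex v))
  | orth (v w : V) : v ≠ w → LeavittRel R (gen R (vertex v) * gen R (vertex w)) 0
  | source_edge (e : W) : LeavittRel R (gen R (vertex (E.s e)) * gen R (edge e)) (gen R (edge e))
  | edge_range (e : W) : LeavittRel R (gen R (edge e) * gen R (vertex (E.r e))) (gen R (edge e))
  | range_ghost (e : W) : LeavittRel R (gen R (vertex (E.r e)) * gen R (ghost e)) (gen R (ghost e))
  | ghost_source (e : W) : LeavittRel R (gen R (ghost e) * gen R (vertex (E.s e))) (gen R (ghost e))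
  | ck1_same (e : W) : LeavittRel R (gen R (ghost e) * gen R (edge e)) (gen R (vertex (E.r e)))
  | ck1_ne (e f : W) : e ≠ f → LeavittRel R (gen R (ghost e) * gen R (edge f)) 0
  | ck2 (v : V) (F : Finset W) : (∀ e, e ∈ F ↔ E.s e = v) → F.Nonempty →
      LeavittRel R (gen R (vertex v)) (∑ e ∈ F, gen R (edge e) * gen R (ghost e))

/-- The `R`-algebra congruence generated by the defining relations. Scalar multiples of the relations
are included because a ring congruence of a non-unital algebra need not be `R`-linear. -/
noncomputable def leavittCon (R : Type*) [CommRing R] : RingCon (FreeGen R V W) :=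
  ringConGen fun x y => ∃ (k : R) (a b : FreeGen R V W), E.LeavittRel R a b ∧ x = k • a ∧ y = k • b

theorem leavittCon_smul (R : Type*) [CommRing R] (k : R) {x y : FreeGen R V W}
    (h : E.leavittCon R x y) : E.leavittCon R (k • x) (k • y) := by
  change RingConGen.Rel _ _ _ at h
  change RingConGen.Rel _ _ _
  induction h with
  | of x y h =>
    obtain ⟨l, a, b, hab, rfl, rfl⟩ := h
    exact .of _ _ ⟨k * l, a, b, hab, (mul_smul k l a).symm, (mul_smul k l b).symm⟩
  | refl x => exact .refl _
  | symm _ ih => exact .symm ih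
  | trans _ _ ih₁ ih₂ => exact .trans ih₁ ih₂
  | add _ _ ih₁ ih₂ => rw [smul_add, smul_add]; exact .add ih₁ ih₂
  | mul _ h₂ ih₁ _ => rw [← smul_mul_assoc, ← smul_mul_assoc]; exact .mul ih₁ h₂

end DirGraph

/-- The Leavitt path algebra `L_R(E)`: the universal (in general non-unital) `R`-algebra generated by a
Leavitt `E`-family; see `LeavittPathAlgebra.existsUnique_hom` for the universal property. -/
def LeavittPathAlgebra (R : Type*) [CommRing R] {V W : Type*} (E : DirGraph V W) : Type _ :=
  (E.leavittCon R).Quotient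

namespace LeavittPathAlgebra

open DirGraph

variable (R : Type*) [CommRing R] {V W : Type*} (E : DirGraph V W)

noncomputable instance : NonUnitalRing (LeavittPathAlgebra R E) :=
  inferInstanceAs (NonUnitalRing (E.leavittCon R).Quotient)

/-- The quotient map from the free algebra. -/
noncomputable def mk (x : FreeGen R V W) : LeavittPathAlgebra R E := RingCon.toQuotient (c := E.leavittCon R) x

noncomputable instance : SMul R (LeavittPathAlgebra R E) where
  smul k := Quotient.map' (fun x => k • x) fun _ _ h => E.leavittCon_smul R k h

theorem mk_surjective : Function.Surjective (mk R E) := Quotient.mk''_surjective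

theorem mk_eq_iff {x y : FreeGen R V W} : mk R E x = mk R E y ↔ E.leavittCon R x y :=
  RingCon.eq _

theorem mk_add (x y : FreeGen R V W) : mk R E (x + y) = mk R E x + mk R E y := rfl
theorem mk_mul (x y : FreeGen R V W) : mk R E (x * y) = mk R E x * mk R E y := rfl
theorem mk_zero : mk R E 0 = 0 := rfl
theorem mk_smul (k : R) (x : FreeGen R V W) : mk R E (k • x) = k • mk R E x := rfl

noncomputable instance : Module R (LeavittPathAlgebra R E) where
  one_smul x := by
    obtain ⟨x, rfl⟩ := mk_surjective R E x
    rw [← mk_smul, one_smul]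
  mul_smul k l x := by
    obtain ⟨x, rfl⟩ := mk_surjective R E x
    rw [← mk_smul, mul_smul, mk_smul, mk_smul]
  smul_zero k := by rw [← mk_zero, ← mk_smul, smul_zero]
  smul_add k x y := by
    obtain ⟨x, rfl⟩ := mk_surjective R E x
    obtain ⟨y, rfl⟩ := mk_surjective R E y
    rw [← mk_add, ← mk_smul, smul_add, mk_add, mk_smul, mk_smul]
  add_smul k l x := by
    obtain ⟨x, rfl⟩ := mk_surjective R E x
    rw [← mk_smul, add_smul, mk_add, mk_smul, mk_smul]
  zero_smul x := by
    obtain ⟨x, rfl⟩ := mk_surjective R E x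
    rw [← mk_smul, zero_smul, mk_zero]

instance : IsScalarTower R (LeavittPathAlgebra R E) (LeavittPathAlgebra R E) where
  smul_assoc k x y := by
    obtain ⟨x, rfl⟩ := mk_surjective R E x
    obtain ⟨y, rfl⟩ := mk_surjective R E y
    rw [smul_eq_mul, smul_eq_mul, ← mk_smul, ← mk_mul, smul_mul_assoc, mk_smul, mk_mul]

instance : SMulCommClass R (LeavittPathAlgebra R E) (LeavittPathAlgebra R E) where
  smul_comm k x y := by
    obtain ⟨x, rfl⟩ := mk_surjective R E x
    obtain ⟨y, rfl⟩ := mk_surjective R E y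
    rw [smul_eq_mul, smul_eq_mul, ← mk_smul R E k y, ← mk_mul, ← mk_mul, mul_smul_comm, mk_smul]

/-- The generator `v`. -/
noncomputable def vertex (v : V) : LeavittPathAlgebra R E := mk R E (gen R (.vertex v))
/-- The generator `e`. -/
noncomputable def edge (e : W) : LeavittPathAlgebra R E := mk R E (gen R (.edge e))
/-- The generator `e^*`. -/
noncomputable def ghost (e : W) : LeavittPathAlgebra R E := mk R E (gen R (.ghost e))

theorem mk_sum {ι : Type*} (F : Finset ι) (f : ι → FreeGen R V W) :
    mk R E (∑ i ∈ F, f i) = ∑ i ∈ F, mk R E (f i) :=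
  map_sum (⟨⟨mk R E, mk_zero R E⟩, mk_add R E⟩ : FreeGen R V W →+ LeavittPathAlgebra R E) f F

theorem mk_eq_of_rel {x y : FreeGen R V W} (h : E.LeavittRel R x y) : mk R E x = mk R E y :=
  (mk_eq_iff R E).2 <| RingConGen.Rel.of _ _
    ⟨1, x, y, h, (one_smul R x).symm, (one_smul R y).symm⟩

/-- The generators form a Leavitt `E`-family. -/
theorem isLeavittFamily : E.IsLeavittFamily (vertex R E) (edge R E) (ghost R E) where
  idem v := mk_eq_of_rel R E (.idem v)
  orth v w h := mk_eq_of_rel R E (.orth v w h)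
  source_edge e := mk_eq_of_rel R E (.source_edge e)
  edge_range e := mk_eq_of_rel R E (.edge_range e)
  range_ghost e := mk_eq_of_rel R E (.range_ghost e)
  ghost_source e := mk_eq_of_rel R E (.ghost_source e)
  ck1_same e := mk_eq_of_rel R E (.ck1_same e)
  ck1_ne e f h := mk_eq_of_rel R E (.ck1_ne e f h)
  ck2 v F hF hne := by
    have h := mk_eq_of_rel R E (.ck2 v F hF hne)
    rw [mk_sum] at h
    exact h

variable {R E} in
/-- The universal property of `L_R(E)`. -/
theorem existsUnique_hom {A : Type*} [NonUnitalRing A] [Module R A] [IsScalarTower R A A]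
    [SMulCommClass R A A] {a : V → A} {b c : W → A} (h : E.IsLeavittFamily a b c) :
    ∃! φ : LeavittPathAlgebra R E →ₙₐ[R] A,
      (∀ v, φ (vertex R E v) = a v) ∧ (∀ e, φ (edge R E e) = b e) ∧
        ∀ e, φ (ghost R E e) = c e := by
  let g : Gen V W → A := fun x => match x with
    | .vertex v => a v
    | .edge e => b e
    | .ghost e => c e
  let ψ : FreeGen R V W →ₙₐ[R] A := MonoidAlgebra.liftMagma R (FreeSemigroup.lift g)
  have hg : ∀ x, ψ (gen R x) = g x := fun x => by
    simp [ψ, gen]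
  have hrel : ∀ x y, E.LeavittRel R x y → ψ x = ψ y := by
    intro x y hxy
    cases hxy with
    | idem v => simpa [hg] using h.idem v
    | orth v w hvw => simpa [hg] using h.orth v w hvw
    | source_edge e => simpa [hg] using h.source_edge e
    | edge_range e => simpa [hg] using h.edge_range e
    | range_ghost e => simpa [hg] using h.range_ghost e
    | ghost_source e => simpa [hg] using h.ghost_source e
    | ck1_same e => simpa [hg] using h.ck1_same e
    | ck1_ne e f hef => simpa [hg] using h.ck1_ne e f hef
    | ck2 v F hF hne => simpa [hg, map_sum] using h.ck2 v F hF hne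
  have hcon : ∀ x y, E.leavittCon R x y → ψ x = ψ y := by
    intro x y hxy
    change RingConGen.Rel _ _ _ at hxy
    induction hxy with
    | of x y hxy =>
      obtain ⟨k, p, q, hpq, rfl, rfl⟩ := hxy
      rw [map_smul, map_smul, hrel _ _ hpq]
    | refl x => rfl
    | symm _ ih => exact ih.symm
    | trans _ _ ih₁ ih₂ => exact ih₁.trans ih₂
    | add _ _ ih₁ ih₂ => rw [map_add, map_add, ih₁, ih₂]
    | mul _ _ ih₁ ih₂ => rw [map_mul, map_mul, ih₁, ih₂]
  let φ₀ : LeavittPathAlgebra R E → A := Quotient.lift (fun x => ψ x) hcon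
  have hφ₀ : ∀ x, φ₀ (mk R E x) = ψ x := fun _ => rfl
  refine ⟨{ toFun := φ₀, map_smul' := ?_, map_zero' := ?_, map_add' := ?_, map_mul' := ?_ },
    ⟨fun v => hg (.vertex v), fun e => hg (.edge e), fun e => hg (.ghost e)⟩, ?_⟩
  · intro k x
    obtain ⟨x, rfl⟩ := mk_surjective R E x
    rw [← mk_smul, hφ₀, hφ₀, map_smul]; rfl
  · rw [← mk_zero, hφ₀, map_zero]
  · intro x y
    obtain ⟨x, rfl⟩ := mk_surjective R E x
    obtain ⟨y, rfl⟩ := mk_surjective R E y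
    rw [← mk_add, hφ₀, hφ₀, hφ₀, map_add]
  · intro x y
    obtain ⟨x, rfl⟩ := mk_surjective R E x
    obtain ⟨y, rfl⟩ := mk_surjective R E y
    rw [← mk_mul, hφ₀, hφ₀, hφ₀, map_mul]
  · rintro θ ⟨hv, he, hc⟩
    let π : FreeGen R V W →ₙₐ[R] LeavittPathAlgebra R E :=
      { toFun := mk R E, map_smul' := mk_smul R E, map_zero' := mk_zero R E,
        map_add' := mk_add R E, map_mul' := mk_mul R E }
    have key : θ.comp π = ψ := by
      apply (MonoidAlgebra.liftMagma R).symm.injective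
      apply FreeSemigroup.hom_ext
      funext x
      change θ (mk R E (gen R x)) = ψ (gen R x)
      rw [hg]
      cases x with
      | vertex v => exact hv v
      | edge e => exact he e
      | ghost e => exact hc e
    ext x
    obtain ⟨x, rfl⟩ := mk_surjective R E x
    exact DFunLike.congr_fun key x

end LeavittPathAlgebra

namespace DirGraph

variable {V W : Type*} (E : DirGraph V W)

/-! ### Admissible pairs -/

/-- `X` is hereditary: edges starting in `X` end in `X`. -/
def IsHereditary (X : Set V) : Prop := ∀ e, E.s e ∈ X → E.r e ∈ X

/-- `v` is a finite emitter: `0 < |s⁻¹(v)| < ∞`. -/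
def IsFiniteEmitter (v : V) : Prop := {e | E.s e = v}.Nonempty ∧ {e | E.s e = v}.Finite

/-- `X` is saturated: a finite emitter all of whose edges end in `X` lies in `X`. -/
def IsSaturated (X : Set V) : Prop :=
  ∀ v, E.IsFiniteEmitter v → (∀ e, E.s e = v → E.r e ∈ X) → v ∈ X

/-- The set `B_H` of vertices outside `H` which emit infinitely many edges, of which a nonzero
finite number end outside `H`. -/
def breakingVertices (H : Set V) : Set V :=
  {v | v ∉ H ∧ {e | E.s e = v}.Infinite ∧ {e | E.s e = v ∧ E.r e ∉ H}.Nonempty ∧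
    {e | E.s e = v ∧ E.r e ∉ H}.Finite}

/-- `(H, S)` is an admissible pair in `E`. -/
structure IsAdmissiblePair (H S : Set V) : Prop where
  hereditary : E.IsHereditary H
  saturated : E.IsSaturated H
  subset : S ⊆ E.breakingVertices H

open LeavittPathAlgebra in
/-- `v^H = v - ∑_{s(e) = v, r(e) ∉ H} e e^*`, used for `v ∈ B_H`, where the sum is finite. -/
noncomputable def breakingElement (R : Type*) [CommRing R] (H : Set V) (v : V) :
    LeavittPathAlgebra R E :=
  vertex R E v - ∑ᶠ e ∈ {e | E.s e = v ∧ E.r e ∉ H}, edge R E e * ghost R E e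

/-- The (two-sided) ideal `I(H, S)` of `L_R(E)` generated by `{v : v ∈ H} ∪ {v^H : v ∈ S}`. -/
noncomputable def idealOf (R : Type*) [CommRing R] (H S : Set V) :
    TwoSidedIdeal (LeavittPathAlgebra R E) :=
  TwoSidedIdeal.span (LeavittPathAlgebra.vertex R E '' H ∪ E.breakingElement R H '' S)

/-! ### The graph `_HE_S` -/

/-- Paths of positive length: nonempty lists `e₁ … eₙ` of edges with `r(eᵢ) = s(eᵢ₊₁)`. -/
structure PosPath where
  edges : List W
  ne_nil : edges ≠ []
  chain : edges.IsChain fun e f => E.r e = E.s f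

variable {E} in
/-- The last edge of a path of positive length. -/
def PosPath.last (α : E.PosPath) : W := α.edges.getLast α.ne_nil

/-- `F₁(H, S)`: paths `e₁ … eₙ` of length `n ≥ 1` with `s(eₙ) ∉ H ∪ S` and `r(eₙ) ∈ H`. -/
def F₁ (H S : Set V) : Set E.PosPath := {α | E.s α.last ∉ H ∪ S ∧ E.r α.last ∈ H}

/-- `F₂(H, S)`: paths of length at least `1` whose range is in `S`. -/
def F₂ (S : Set V) : Set E.PosPath := {α | E.r α.last ∈ S}

/-- The vertex set `H ∪ S ∪ F₁(H, S) ∪ F₂(H, S)` of `_HE_S` (for an admissible pair the four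
sets are pairwise disjoint). -/
inductive HSVertex (H S : Set V)
  | ofH (v : H)
  | ofS (v : S)
  | ofF₁ (α : E.F₁ H S)
  | ofF₂ (α : E.F₂ S)

/-- The edge set of `_HE_S`: the edges of `E` starting in `H`, the edges of `E` from `S` to `H`, and
one edge `bar α` for every `α` in `F₁(H, S)` or `F₂(H, S)`. -/
inductive HSEdge (H S : Set V)
  | ofH (e : W) (hs : E.s e ∈ H)
  | ofS (e : W) (hs : E.s e ∈ S) (hr : E.r e ∈ H)
  | bar₁ (α : E.F₁ H S)
  | bar₂ (α : E.F₂ S)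

/-- The graph `_HE_S`. Edges of `E` keep their source and range, and `bar α` goes from the vertex `α`
to the vertex `r(α)`. Heredity of `H` puts the range of an edge that starts in `H` into `H`. -/
def hsGraph (H S : Set V) (hH : E.IsHereditary H) : DirGraph (E.HSVertex H S) (E.HSEdge H S) where
  s
    | .ofH e hs => .ofH ⟨E.s e, hs⟩
    | .ofS e hs _ => .ofS ⟨E.s e, hs⟩
    | .bar₁ α => .ofF₁ α
    | .bar₂ α => .ofF₂ α
  r
    | .ofH e hs => .ofH ⟨E.r e, hH e hs⟩
    | .ofS e _ hr => .ofH ⟨E.r e, hr⟩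
    | .bar₁ α => .ofH ⟨E.r α.1.last, α.2.2⟩
    | .bar₂ α => .ofS ⟨E.r α.1.last, α.2⟩

end DirGraph

/-- `U` is a set of local units for the ring `A`: a set of commuting idempotents such that every `x`
satisfies `u x = x u = x` for some `u` in `U`. -/
structure IsSetOfLocalUnits {A : Type*} [NonUnitalRing A] (U : Set A) : Prop where
  idem : ∀ u ∈ U, u * u = u
  comm : ∀ u ∈ U, ∀ w ∈ U, u * w = w * u
  unit : ∀ x, ∃ u ∈ U, u * x = x ∧ x * u = x

namespace LeavittPathAlgebra

open DirGraph

variable {R : Type*} [CommRing R] {V W : Type*} {E : DirGraph V W}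

/-! Write t_p for `toLPA R p`: t_v = v for v in H, t_v = v^H for v in S, t_α = α for α in F₁ and t_α
= α r(α)^H for α in F₂. Let r(p) be the range of p, with r(p) = p on H and S. In L_R(E) one has
t_p^* t_p = t_{r(p)}, and t_p^* t_q = 0 for p ≠ q (`star_toLPA_mul_toLPA_self`,
`star_toLPA_mul_toLPA_of_ne`). Hence the projections t_p t_p^*, together with the edges of E kept in
_HE_S and the t_α as images of the edges bar α, form a Leavitt family for _HE_S
(`isLeavittFamily_toLPA`), and this gives φ = `hsHom`.

The image of φ lies in I(H, S) because t_p = t_p t_{r(p)}, and it contains the generators of I(H,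
S). It is an ideal: a generator of L_R(E) sends t_p to 0 or to some t_q φ(c), and the involution
turns left multiplication into right multiplication (`mul_hsHom_mem_range`, `hsHom_mul_mem_range`).

Injectivity comes from a representation. As a right module, L = L_R(_HE_S) is the direct sum of the
pL, and pL ≅ r(p)L. The formulas for e t_p and e^* t_p dictate how L_R(E) should act on families of
coordinates, and the resulting operators form a Leavitt E-family (`isLeavittFamily_ops`). Composed
with φ, this action is left multiplication of L on itself (`hsRep_hsHom_coords`). So φ(x) = 0 forces
xL = 0, and then x = 0 because finite sums of vertices are local units of L. The isomorphism carries
these local units to I(H, S). -/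

@[elab_as_elim]
theorem induction {p : LeavittPathAlgebra R E → Prop} (hv : ∀ v, p (vertex R E v))
    (he : ∀ e, p (edge R E e)) (hg : ∀ e, p (ghost R E e)) (zero : p 0)
    (add : ∀ x y, p x → p y → p (x + y)) (mul : ∀ x y, p x → p y → p (x * y))
    (smul : ∀ (k : R) x, p x → p (k • x)) (x : LeavittPathAlgebra R E) : p x := by
  obtain ⟨x, rfl⟩ := mk_surjective R E x
  have of : ∀ m : FreeSemigroup (Gen V W), p (mk R E (MonoidAlgebra.single m 1)) := by
    intro m
    induction m using FreeSemigroup.recOnMul with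
    | ih1 x =>
      cases x with
      | vertex v => exact hv v
      | edge e => exact he e
      | ghost e => exact hg e
    | ih2 x y hx hy =>
      have := mul _ _ hx hy
      rwa [← mk_mul, MonoidAlgebra.single_mul_single, mul_one] at this
  induction x using MonoidAlgebra.induction_linear with
  | zero => exact zero
  | add f g hf hg => exact add _ _ hf hg
  | single m k =>
    have := smul k _ (of m)
    rwa [← mk_smul, MonoidAlgebra.smul_single, smul_eq_mul, mul_one] at this

/-! ### The involution -/

/-- Reversing products while exchanging e and e^* permutes the defining relations, so the universal
property yields the involution. -/
theorem isLeavittFamily_op : E.IsLeavittFamily (fun v => MulOpposite.op (vertex R E v))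
    (fun e => MulOpposite.op (ghost R E e)) (fun e => MulOpposite.op (edge R E e)) := by
  have h := isLeavittFamily R E
  constructor
  · intro v; rw [← MulOpposite.op_mul, h.idem]
  · intro v w hvw; rw [← MulOpposite.op_mul, h.orth _ _ hvw.symm, MulOpposite.op_zero]
  · intro e; rw [← MulOpposite.op_mul, h.ghost_source]
  · intro e; rw [← MulOpposite.op_mul, h.range_ghost]
  · intro e; rw [← MulOpposite.op_mul, h.edge_range]
  · intro e; rw [← MulOpposite.op_mul, h.source_edge]
  · intro e; rw [← MulOpposite.op_mul, h.ck1_same]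
  · intro e f hef; rw [← MulOpposite.op_mul, h.ck1_ne _ _ hef.symm, MulOpposite.op_zero]
  · intro v F hF hne
    simp only [← MulOpposite.op_mul]
    rw [h.ck2 v F hF hne, Finset.op_sum]

/-- The involution of `L_R(E)` as a homomorphism to the opposite algebra. -/
noncomputable def starHom (R : Type*) [CommRing R] {V W : Type*} (E : DirGraph V W) :
    LeavittPathAlgebra R E →ₙₐ[R] (LeavittPathAlgebra R E)ᵐᵒᵖ :=
  (existsUnique_hom (isLeavittFamily_op (R := R) (E := E))).choose

theorem starHom_vertex (v : V) : starHom R E (vertex R E v) = MulOpposite.op (vertex R E v) :=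
  (existsUnique_hom (isLeavittFamily_op (R := R) (E := E))).choose_spec.1.1 v

theorem starHom_edge (e : W) : starHom R E (edge R E e) = MulOpposite.op (ghost R E e) :=
  (existsUnique_hom (isLeavittFamily_op (R := R) (E := E))).choose_spec.1.2.1 e

theorem starHom_ghost (e : W) : starHom R E (ghost R E e) = MulOpposite.op (edge R E e) :=
  (existsUnique_hom (isLeavittFamily_op (R := R) (E := E))).choose_spec.1.2.2 e

theorem unop_starHom_unop_starHom (x : LeavittPathAlgebra R E) :
    (starHom R E (starHom R E x).unop).unop = x := by
  induction x using LeavittPathAlgebra.induction with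
  | hv v => simp [starHom_vertex]
  | he e => simp [starHom_edge, starHom_ghost]
  | hg e => simp [starHom_edge, starHom_ghost]
  | zero => simp
  | add x y hx hy => simp [hx, hy]
  | mul x y hx hy => simp [hx, hy]
  | smul k x hx => simp [hx]

noncomputable instance : StarRing (LeavittPathAlgebra R E) where
  star x := (starHom R E x).unop
  star_involutive x := unop_starHom_unop_starHom x
  star_mul x y := by rw [map_mul, MulOpposite.unop_mul]
  star_add x y := by rw [map_add, MulOpposite.unop_add]

@[simp]
theorem star_vertex (v : V) : star (vertex R E v) = vertex R E v :=
  congrArg MulOpposite.unop (starHom_vertex v)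

@[simp]
theorem star_edge (e : W) : star (edge R E e) = ghost R E e :=
  congrArg MulOpposite.unop (starHom_edge e)

@[simp]
theorem star_ghost (e : W) : star (ghost R E e) = edge R E e :=
  congrArg MulOpposite.unop (starHom_ghost e)

theorem star_smul' (k : R) (x : LeavittPathAlgebra R E) : star (k • x) = k • star x :=
  (congrArg MulOpposite.unop (map_smul (starHom R E) k x)).trans rfl

/-! ### Relations among the generators -/

@[simp]
theorem vertex_mul_self (v : V) : vertex R E v * vertex R E v = vertex R E v :=
  (isLeavittFamily R E).idem v

theorem vertex_mul_of_ne {v w : V} (h : v ≠ w) : vertex R E v * vertex R E w = 0 :=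
  (isLeavittFamily R E).orth v w h

@[simp]
theorem vertex_mul_edge (e : W) : vertex R E (E.s e) * edge R E e = edge R E e :=
  (isLeavittFamily R E).source_edge e

@[simp]
theorem edge_mul_vertex (e : W) : edge R E e * vertex R E (E.r e) = edge R E e :=
  (isLeavittFamily R E).edge_range e

@[simp]
theorem vertex_mul_ghost (e : W) : vertex R E (E.r e) * ghost R E e = ghost R E e :=
  (isLeavittFamily R E).range_ghost e

@[simp]
theorem ghost_mul_vertex (e : W) : ghost R E e * vertex R E (E.s e) = ghost R E e :=
  (isLeavittFamily R E).ghost_source e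

@[simp]
theorem ghost_mul_edge (e : W) : ghost R E e * edge R E e = vertex R E (E.r e) :=
  (isLeavittFamily R E).ck1_same e

theorem ghost_mul_edge_of_ne {e f : W} (h : e ≠ f) : ghost R E e * edge R E f = 0 :=
  (isLeavittFamily R E).ck1_ne e f h

theorem vertex_mul_edge_of_ne {v : V} {e : W} (h : v ≠ E.s e) : vertex R E v * edge R E e = 0 := by
  rw [← vertex_mul_edge, ← mul_assoc, vertex_mul_of_ne h, zero_mul]

theorem edge_mul_vertex_of_ne {v : V} {e : W} (h : E.r e ≠ v) :
    edge R E e * vertex R E v = 0 := by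
  rw [← edge_mul_vertex, mul_assoc, vertex_mul_of_ne h, mul_zero]

theorem ghost_mul_vertex_of_ne {v : V} {e : W} (h : E.s e ≠ v) :
    ghost R E e * vertex R E v = 0 := by
  rw [← ghost_mul_vertex, mul_assoc, vertex_mul_of_ne h, mul_zero]

/-! ### Local units -/

open Classical in
theorem sum_vertex_mul_vertex {F : Finset V} (v : V) :
    (∑ w ∈ F, vertex R E w) * vertex R E v = if v ∈ F then vertex R E v else 0 := by
  rw [Finset.sum_mul]
  have : ∀ w ∈ F, vertex R E w * vertex R E v = if v = w then vertex R E v else 0 := by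
    intro w _
    split_ifs with h
    · rw [h, vertex_mul_self]
    · exact vertex_mul_of_ne (Ne.symm h)
  rw [Finset.sum_congr rfl this, Finset.sum_ite_eq]

theorem star_sum_vertex (F : Finset V) :
    star (∑ w ∈ F, vertex R E w) = ∑ w ∈ F, vertex R E w := by
  rw [star_sum]
  exact Finset.sum_congr rfl fun _ _ => star_vertex _

theorem sum_vertex_mul_self (F : Finset V) :
    (∑ w ∈ F, vertex R E w) * ∑ w ∈ F, vertex R E w = ∑ w ∈ F, vertex R E w := by
  rw [Finset.mul_sum]
  refine Finset.sum_congr rfl fun v hv => ?_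
  rw [sum_vertex_mul_vertex, if_pos hv]

theorem sum_vertex_mul_comm (F F' : Finset V) :
    (∑ w ∈ F, vertex R E w) * (∑ w ∈ F', vertex R E w) =
      (∑ w ∈ F', vertex R E w) * ∑ w ∈ F, vertex R E w := by
  rw [Finset.sum_mul_sum, Finset.sum_mul_sum, Finset.sum_comm]
  refine Finset.sum_congr rfl fun v _ => Finset.sum_congr rfl fun w _ => ?_
  by_cases h : v = w
  · rw [h]
  · rw [vertex_mul_of_ne h, vertex_mul_of_ne (Ne.symm h)]

theorem sum_vertex_mul_eq_self_of_mem {F : Finset V} {v : V} (hv : v ∈ F)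
    {x : LeavittPathAlgebra R E} (hx : vertex R E v * x = x) :
    (∑ w ∈ F, vertex R E w) * x = x := by
  rw [← hx, ← mul_assoc, sum_vertex_mul_vertex, if_pos hv]

/-- Asking for all larger finite sets makes the property stable under sums: two finite sets are
replaced by their union. -/
theorem exists_sum_vertex_mul (x : LeavittPathAlgebra R E) :
    ∃ F : Finset V, ∀ F', F ⊆ F' → (∑ w ∈ F', vertex R E w) * x = x := by
  classical
  induction x using LeavittPathAlgebra.induction with
  | hv v => exact ⟨{v}, fun F' h => sum_vertex_mul_eq_self_of_mem (h (by simp)) (vertex_mul_self v)⟩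
  | he e =>
    exact ⟨{E.s e}, fun F' h => sum_vertex_mul_eq_self_of_mem (h (by simp)) (vertex_mul_edge e)⟩
  | hg e =>
    exact ⟨{E.r e}, fun F' h => sum_vertex_mul_eq_self_of_mem (h (by simp)) (vertex_mul_ghost e)⟩
  | zero => exact ⟨∅, fun _ _ => mul_zero _⟩
  | add x y hx hy =>
    obtain ⟨F, hF⟩ := hx
    obtain ⟨G, hG⟩ := hy
    refine ⟨F ∪ G, fun F' h => ?_⟩
    rw [mul_add, hF F' (Finset.union_subset_left h), hG F' (Finset.union_subset_right h)]
  | mul x y hx hy =>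
    obtain ⟨F, hF⟩ := hx
    exact ⟨F, fun F' h => by rw [← mul_assoc, hF F' h]⟩
  | smul k x hx =>
    obtain ⟨F, hF⟩ := hx
    exact ⟨F, fun F' h => by rw [mul_smul_comm, hF F' h]⟩

theorem exists_sum_vertex_mul_and_mul (x : LeavittPathAlgebra R E) :
    ∃ F : Finset V, (∑ w ∈ F, vertex R E w) * x = x ∧ x * (∑ w ∈ F, vertex R E w) = x := by
  classical
  obtain ⟨F, hF⟩ := exists_sum_vertex_mul x
  obtain ⟨G, hG⟩ := exists_sum_vertex_mul (star x)
  refine ⟨F ∪ G, hF _ Finset.subset_union_left, star_injective ?_⟩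
  rw [star_mul, star_sum_vertex, hG _ Finset.subset_union_right]

theorem isSetOfLocalUnits_range_sum_vertex :
    IsSetOfLocalUnits (Set.range fun F : Finset V => ∑ w ∈ F, vertex R E w) where
  idem := by
    rintro _ ⟨F, rfl⟩
    exact sum_vertex_mul_self F
  comm := by
    rintro _ ⟨F, rfl⟩ _ ⟨F', rfl⟩
    exact sum_vertex_mul_comm F F'
  unit x := by
    obtain ⟨F, hF⟩ := exists_sum_vertex_mul_and_mul x
    exact ⟨_, ⟨F, rfl⟩, hF⟩

/-- To prove an additive property it suffices to prove it on each `v L_R(E)`. -/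
theorem induction_vertex_mul {p : LeavittPathAlgebra R E → Prop} (zero : p 0)
    (add : ∀ x y, p x → p y → p (x + y)) (hv : ∀ v x, p (vertex R E v * x))
    (x : LeavittPathAlgebra R E) : p x := by
  obtain ⟨F, hF, -⟩ := exists_sum_vertex_mul_and_mul x
  rw [← hF, Finset.sum_mul]
  exact Finset.sum_induction _ p add zero fun v _ => hv v x

theorem eq_zero_of_vertex_mul {x : LeavittPathAlgebra R E} (h : ∀ v, vertex R E v * x = 0) :
    x = 0 := by
  obtain ⟨F, hF, -⟩ := exists_sum_vertex_mul_and_mul x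
  rw [← hF, Finset.sum_mul]
  exact Finset.sum_eq_zero fun v _ => h v

/-- The left regular representation is faithful; injectivity of `hsHom` is reduced to this. -/
theorem eq_zero_of_mul_right {x : LeavittPathAlgebra R E} (h : ∀ a, x * a = 0) : x = 0 := by
  obtain ⟨F, -, hF⟩ := exists_sum_vertex_mul_and_mul x
  rw [← hF, h]

end LeavittPathAlgebra

theorem IsSetOfLocalUnits.image {A B : Type*} [NonUnitalRing A] [NonUnitalRing B] {U : Set A}
    (hU : IsSetOfLocalUnits U) (f : A ≃+* B) : IsSetOfLocalUnits (f '' U) where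
  idem := by
    rintro _ ⟨u, hu, rfl⟩
    rw [← map_mul, hU.idem u hu]
  comm := by
    rintro _ ⟨u, hu, rfl⟩ _ ⟨w, hw, rfl⟩
    rw [← map_mul, ← map_mul, hU.comm u hu w hw]
  unit x := by
    obtain ⟨u, hu, h₁, h₂⟩ := hU.unit (f.symm x)
    refine ⟨f u, ⟨u, hu, rfl⟩, ?_, ?_⟩ <;> apply f.symm.injective <;> simpa

/-! ### Combinatorics of the vertices of _HE_S as paths in E -/

namespace DirGraph

open LeavittPathAlgebra

variable {V W : Type*} {E : DirGraph V W} {H S : Set V}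

theorem PosPath.ext_edges {α β : E.PosPath} (h : α.edges = β.edges) : α = β := by
  cases α; cases β; cases h; rfl

/-- The first edge of a path of positive length. -/
def PosPath.first (α : E.PosPath) : W := α.edges.head α.ne_nil

theorem IsAdmissiblePair.notMem_left (h : E.IsAdmissiblePair H S) {v : V} (hv : v ∈ S) : v ∉ H :=
  (h.subset hv).1

namespace HSVertex

/-- The source of a vertex of `_HE_S` seen as a path in `E`. -/
def src : E.HSVertex H S → V
  | ofH v => v
  | ofS v => v
  | ofF₁ α => E.s α.1.first
  | ofF₂ α => E.s α.1.first

/-- The range of a vertex of `_HE_S` seen as a path in `E`. -/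
def base : E.HSVertex H S → E.HSVertex H S
  | ofH v => ofH v
  | ofS v => ofS v
  | ofF₁ α => ofH ⟨E.r α.1.last, α.2.2⟩
  | ofF₂ α => ofS ⟨E.r α.1.last, α.2⟩

/-- `Cons e p q` says that the path `q` is the edge `e` followed by the path `p`. -/
inductive Cons (e : W) : E.HSVertex H S → E.HSVertex H S → Prop
  | single₁ (v : H) (α : E.F₁ H S) : E.r e = v → α.1.edges = [e] → Cons e (ofH v) (ofF₁ α)
  | single₂ (v : S) (α : E.F₂ S) : E.r e = v → α.1.edges = [e] → Cons e (ofS v) (ofF₂ α)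
  | cons₁ (α β : E.F₁ H S) : β.1.edges = e :: α.1.edges → Cons e (ofF₁ α) (ofF₁ β)
  | cons₂ (α β : E.F₂ S) : β.1.edges = e :: α.1.edges → Cons e (ofF₂ α) (ofF₂ β)

end HSVertex

open HSVertex

theorem PosPath.range_eq_source_first {α β : E.PosPath} {e : W} (h : β.edges = e :: α.edges) :
    E.r e = E.s α.first := by
  have hc := β.chain
  rw [h, List.isChain_cons] at hc
  exact hc.1 _ (by simp [first, List.head?_eq_some_head α.ne_nil])

theorem PosPath.last_eq_of_cons {α β : E.PosPath} {e : W} (h : β.edges = e :: α.edges) :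
    β.last = α.last := by
  simp only [last, h, List.getLast_cons α.ne_nil]

theorem PosPath.first_eq_of_cons {β : E.PosPath} {e : W} {l : List W} (h : β.edges = e :: l) :
    β.first = e := by
  simp only [first, h, List.head_cons]

theorem PosPath.last_eq_of_singleton {β : E.PosPath} {e : W} (h : β.edges = [e]) :
    β.last = e := by
  simp only [last, h, List.getLast_singleton]

theorem IsHereditary.last_of_mem (hH : E.IsHereditary H) (l : List W)
    (hc : l.IsChain fun e f => E.r e = E.s f) (hne : l ≠ []) (h : E.s (l.head hne) ∈ H) :
    E.s (l.getLast hne) ∈ H := by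
  induction l with
  | nil => exact absurd rfl hne
  | cons e l ih =>
    cases l with
    | nil => simpa using h
    | cons f l =>
      rw [List.isChain_cons_cons] at hc
      rw [List.getLast_cons (by simp)]
      refine ih hc.2 (by simp) ?_
      rw [List.head_cons, ← hc.1]
      exact hH e h

/-- A path that starts in H stays in H, so its last edge would start in H, which F₁ forbids. -/
theorem IsHereditary.source_first_notMem₁ (hH : E.IsHereditary H) (α : E.F₁ H S) :
    E.s α.1.first ∉ H := fun h =>
  α.2.1 (Or.inl (hH.last_of_mem _ α.1.chain α.1.ne_nil h))

theorem IsAdmissiblePair.source_first_notMem₂ (h : E.IsAdmissiblePair H S) (α : E.F₂ S) :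
    E.s α.1.first ∉ H := fun hα =>
  h.notMem_left α.2 (h.hereditary _ (h.hereditary.last_of_mem _ α.1.chain α.1.ne_nil hα))

namespace HSVertex

variable {e f : W} {p p' q q' : E.HSVertex H S}

theorem Cons.src_left (hc : Cons e p q) : p.src = E.r e := by
  cases hc with
  | single₁ v α hv hα => exact hv.symm
  | single₂ v α hv hα => exact hv.symm
  | cons₁ α β hα => exact (PosPath.range_eq_source_first hα).symm
  | cons₂ α β hα => exact (PosPath.range_eq_source_first hα).symm

theorem Cons.src_right (hc : Cons e p q) : q.src = E.s e := by
  cases hc with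
  | single₁ v α hv hα => exact congrArg E.s (PosPath.first_eq_of_cons hα)
  | single₂ v α hv hα => exact congrArg E.s (PosPath.first_eq_of_cons hα)
  | cons₁ α β hα => exact congrArg E.s (PosPath.first_eq_of_cons hα)
  | cons₂ α β hα => exact congrArg E.s (PosPath.first_eq_of_cons hα)

theorem Cons.base_eq (hc : Cons e p q) : q.base = p.base := by
  cases hc with
  | single₁ v α hv hα => simp only [base, PosPath.last_eq_of_singleton hα, hv]
  | single₂ v α hv hα => simp only [base, PosPath.last_eq_of_singleton hα, hv]
  | cons₁ α β hα => simp only [base, PosPath.last_eq_of_cons hα]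
  | cons₂ α β hα => simp only [base, PosPath.last_eq_of_cons hα]

theorem Cons.source_notMem (h : E.IsAdmissiblePair H S) (hc : Cons e p q) : E.s e ∉ H := by
  rw [← hc.src_right]
  cases hc with
  | single₁ v α hv hα => exact h.hereditary.source_first_notMem₁ α
  | single₂ v α hv hα => exact h.source_first_notMem₂ α
  | cons₁ α β hα => exact h.hereditary.source_first_notMem₁ β
  | cons₂ α β hα => exact h.source_first_notMem₂ β

/-- For a path of length one this is the condition s(eₙ) ∉ S in F₁: an edge from S to H is an edge
of _HE_S and not one of its vertices. Longer paths continue outside H, and S is disjoint from H. -/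
theorem Cons.range_notMem (h : E.IsAdmissiblePair H S) (hc : Cons e p q) (hs : E.s e ∈ S) :
    E.r e ∉ H := by
  cases hc with
  | single₁ v α hv hα =>
    have := α.2.1
    rw [PosPath.last_eq_of_singleton hα] at this
    exact absurd (Or.inr hs) this
  | single₂ v α hv hα => exact hv ▸ h.notMem_left v.2
  | cons₁ α β hα =>
    exact PosPath.range_eq_source_first hα ▸ h.hereditary.source_first_notMem₁ α
  | cons₂ α β hα => exact PosPath.range_eq_source_first hα ▸ h.source_first_notMem₂ α

theorem Cons.left_unique (hc : Cons e p q) (hc' : Cons f p' q) : e = f ∧ p = p' := by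
  cases hc with
  | single₁ v α hv hα =>
    cases hc' with
    | single₁ w _ hw hα' =>
      obtain rfl : e = f := by simpa [hα] using hα'
      exact ⟨rfl, congrArg ofH (Subtype.ext (hv.symm.trans hw))⟩
    | cons₁ β _ hα' => exact absurd ((List.cons_eq_cons.1 (hα.symm.trans hα')).2.symm) β.1.ne_nil
  | single₂ v α hv hα =>
    cases hc' with
    | single₂ w _ hw hα' =>
      obtain rfl : e = f := by simpa [hα] using hα'
      exact ⟨rfl, congrArg ofS (Subtype.ext (hv.symm.trans hw))⟩
    | cons₂ β _ hα' => exact absurd ((List.cons_eq_cons.1 (hα.symm.trans hα')).2.symm) β.1.ne_nil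
  | cons₁ β α hα =>
    cases hc' with
    | single₁ w _ hw hα' => exact absurd ((List.cons_eq_cons.1 (hα.symm.trans hα')).2) β.1.ne_nil
    | cons₁ γ _ hα' =>
      obtain ⟨rfl, h⟩ := List.cons_eq_cons.1 (hα.symm.trans hα')
      exact ⟨rfl, congrArg ofF₁ (Subtype.ext (PosPath.ext_edges h))⟩
  | cons₂ β α hα =>
    cases hc' with
    | single₂ w _ hw hα' => exact absurd ((List.cons_eq_cons.1 (hα.symm.trans hα')).2) β.1.ne_nil
    | cons₂ γ _ hα' =>
      obtain ⟨rfl, h⟩ := List.cons_eq_cons.1 (hα.symm.trans hα')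
      exact ⟨rfl, congrArg ofF₂ (Subtype.ext (PosPath.ext_edges h))⟩

theorem Cons.right_unique (hc : Cons e p q) (hc' : Cons e p q') : q = q' := by
  cases hc with
  | single₁ v α hv hα =>
    cases hc' with
    | single₁ _ β hw hα' =>
      exact congrArg ofF₁ (Subtype.ext (PosPath.ext_edges (hα.trans hα'.symm)))
  | single₂ v α hv hα =>
    cases hc' with
    | single₂ _ β hw hα' =>
      exact congrArg ofF₂ (Subtype.ext (PosPath.ext_edges (hα.trans hα'.symm)))
  | cons₁ β α hα =>
    cases hc' with
    | cons₁ _ γ hα' => exact congrArg ofF₁ (Subtype.ext (PosPath.ext_edges (hα.trans hα'.symm)))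
  | cons₂ β α hα =>
    cases hc' with
    | cons₂ _ γ hα' => exact congrArg ofF₂ (Subtype.ext (PosPath.ext_edges (hα.trans hα'.symm)))

theorem exists_cons_ofF₁ (α : E.F₁ H S) : ∃ e p, Cons e p (ofF₁ α) := by
  obtain ⟨⟨l, hne, hc⟩, hα⟩ := α
  match l, hne, hc, hα with
  | [e], hne, hc, hα => exact ⟨e, ofH ⟨E.r e, hα.2⟩, .single₁ _ _ rfl rfl⟩
  | e :: f :: l, hne, hc, hα =>
    exact ⟨e, ofF₁ ⟨⟨f :: l, by simp, (List.isChain_cons_cons.1 hc).2⟩, hα⟩, .cons₁ _ _ rfl⟩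

theorem exists_cons_ofF₂ (α : E.F₂ S) : ∃ e p, Cons e p (ofF₂ α : E.HSVertex H S) := by
  obtain ⟨⟨l, hne, hc⟩, hα⟩ := α
  match l, hne, hc, hα with
  | [e], hne, hc, hα => exact ⟨e, ofS ⟨E.r e, hα⟩, .single₂ _ _ rfl rfl⟩
  | e :: f :: l, hne, hc, hα =>
    exact ⟨e, ofF₂ ⟨⟨f :: l, by simp, (List.isChain_cons_cons.1 hc).2⟩, hα⟩, .cons₂ _ _ rfl⟩

/-- The length of a vertex of `_HE_S` seen as a path in `E`. -/
def length : E.HSVertex H S → ℕ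
  | ofH _ => 0
  | ofS _ => 0
  | ofF₁ α => α.1.edges.length
  | ofF₂ α => α.1.edges.length

theorem Cons.length_lt (hc : Cons e p q) : p.length < q.length := by
  cases hc with
  | single₁ v α hv hα => simp [length, hα]
  | single₂ v α hv hα => simp [length, hα]
  | cons₁ α β hα => simp [length, hα]
  | cons₂ α β hα => simp [length, hα]

-- Every vertex of _HE_S arises from one in H or S by prepending edges, so this single induction
-- replaces separate arguments for F₁ and F₂.
@[elab_as_elim]
theorem cons_induction {motive : E.HSVertex H S → Prop} (ofH : ∀ v, motive (.ofH v))
    (ofS : ∀ v, motive (.ofS v)) (cons : ∀ e p q, Cons e p q → motive p → motive q)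
    (p : E.HSVertex H S) : motive p := by
  induction hn : p.length using Nat.strong_induction_on generalizing p with
  | _ n ih =>
    cases p with
    | ofH v => exact ofH v
    | ofS v => exact ofS v
    | ofF₁ α =>
      obtain ⟨e, p, hc⟩ := exists_cons_ofF₁ α
      exact cons e p _ hc (ih _ (hn ▸ hc.length_lt) p rfl)
    | ofF₂ α =>
      obtain ⟨e, p, hc⟩ := exists_cons_ofF₂ (H := H) α
      exact cons e p _ hc (ih _ (hn ▸ hc.length_lt) p rfl)

/-- The excluded edges, those that start in H or run from S to H, are exactly the edges of E kept in
_HE_S. -/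
theorem exists_cons_of_src (hp : p.src = E.r e) (hs : E.s e ∉ H)
    (hS : E.s e ∈ S → E.r e ∉ H) : ∃ q, Cons e p q := by
  cases p with
  | ofH v =>
    have hv : E.r e ∈ H := hp ▸ v.2
    exact ⟨ofF₁ ⟨⟨[e], by simp, by simp⟩, fun hm => hm.elim hs fun h => hS h hv, hv⟩,
      .single₁ _ _ hp.symm rfl⟩
  | ofS v =>
    have hv : E.r e ∈ S := hp ▸ v.2
    exact ⟨ofF₂ ⟨⟨[e], by simp, by simp⟩, hv⟩, .single₂ _ _ hp.symm rfl⟩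
  | ofF₁ α =>
    have hc : (e :: α.1.edges).IsChain fun e f => E.r e = E.s f := by
      refine List.isChain_cons.2 ⟨fun f hf => ?_, α.1.chain⟩
      rw [List.head?_eq_some_head α.1.ne_nil, Option.mem_some_iff] at hf
      exact hf ▸ hp.symm
    let β : E.PosPath := ⟨e :: α.1.edges, by simp, hc⟩
    have hβ : β.last = α.1.last := PosPath.last_eq_of_cons rfl
    exact ⟨ofF₁ ⟨β, by
      change E.s β.last ∉ H ∪ S ∧ E.r β.last ∈ H
      rw [hβ]; exact α.2⟩, .cons₁ _ _ rfl⟩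
  | ofF₂ α =>
    have hc : (e :: α.1.edges).IsChain fun e f => E.r e = E.s f := by
      refine List.isChain_cons.2 ⟨fun f hf => ?_, α.1.chain⟩
      rw [List.head?_eq_some_head α.1.ne_nil, Option.mem_some_iff] at hf
      exact hf ▸ hp.symm
    let β : E.PosPath := ⟨e :: α.1.edges, by simp, hc⟩
    have hβ : β.last = α.1.last := PosPath.last_eq_of_cons rfl
    exact ⟨ofF₂ ⟨β, by
      change E.r β.last ∈ S
      rw [hβ]; exact α.2⟩, .cons₂ _ _ rfl⟩

theorem base_base (p : E.HSVertex H S) : p.base.base = p.base := by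
  cases p <;> rfl

/-- `Step e p q` says that left multiplication by `e` maps the summand of `p` to that of `q`. -/
inductive Step (e : W) : E.HSVertex H S → E.HSVertex H S → Prop
  | ofH (v w : H) : E.r e = v → E.s e = w → Step e (ofH v) (ofH w)
  | ofS (v : H) (w : S) : E.r e = v → E.s e = w → Step e (ofH v) (ofS w)
  | cons {p q : E.HSVertex H S} : Cons e p q → Step e p q

theorem Step.src_left (hc : Step e p q) : p.src = E.r e := by
  cases hc with
  | ofH v w hv hw => exact hv.symm
  | ofS v w hv hw => exact hv.symm
  | cons hc => exact hc.src_left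

theorem Step.src_right (hc : Step e p q) : q.src = E.s e := by
  cases hc with
  | ofH v w hv hw => exact hw.symm
  | ofS v w hv hw => exact hw.symm
  | cons hc => exact hc.src_right

theorem Step.left_unique (hc : Step e p q) (hc' : Step e p' q) : p = p' := by
  cases hc with
  | ofH v w hv hw =>
    cases hc' with
    | ofH v' _ hv' hw' => exact congrArg HSVertex.ofH (Subtype.ext (hv.symm.trans hv'))
    | cons hc => cases hc
  | ofS v w hv hw =>
    cases hc' with
    | ofS v' _ hv' hw' => exact congrArg HSVertex.ofH (Subtype.ext (hv.symm.trans hv'))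
    | cons hc => cases hc
  | cons hc =>
    cases hc' with
    | ofH v' _ hv' hw' => cases hc
    | ofS v' _ hv' hw' => cases hc
    | cons hc' => exact (hc.left_unique hc').2

/-- With `Step.left_unique` this makes `Step e` a partial injection. Two different kinds of step
cannot share e and p, because H and S are disjoint and because of `Cons.source_notMem` and
`Cons.range_notMem`. -/
theorem Step.right_unique (h : E.IsAdmissiblePair H S) (hc : Step e p q) (hc' : Step e p q') :
    q = q' := by
  cases hc with
  | ofH v w hv hw =>
    cases hc' with
    | ofH _ w' hv' hw' => exact congrArg HSVertex.ofH (Subtype.ext (hw.symm.trans hw'))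
    | ofS _ w' hv' hw' => exact absurd (hw' ▸ hw ▸ w.2) (h.notMem_left w'.2)
    | cons hc => exact absurd (hw ▸ w.2) (hc.source_notMem h)
  | ofS v w hv hw =>
    cases hc' with
    | ofH _ w' hv' hw' => exact absurd (hw ▸ hw' ▸ w'.2) (h.notMem_left w.2)
    | ofS _ w' hv' hw' => exact congrArg HSVertex.ofS (Subtype.ext (hw.symm.trans hw'))
    | cons hc => exact absurd (hv ▸ v.2) (hc.range_notMem h (hw ▸ w.2))
  | cons hc =>
    cases hc' with
    | ofH v w hv' hw' => exact absurd (hw' ▸ w.2) (hc.source_notMem h)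
    | ofS v w hv' hw' => exact absurd (hv' ▸ v.2) (hc.range_notMem h (hw' ▸ w.2))
    | cons hc' => exact hc.right_unique hc'

theorem eq_ofH_of_src_mem (h : E.IsAdmissiblePair H S) {v : V} (hp : p.src = v) (hv : v ∈ H) :
    p = ofH ⟨v, hv⟩ := by
  subst hp
  cases p with
  | ofH v => rfl
  | ofS w => exact absurd hv (h.notMem_left w.2)
  | ofF₁ α => exact absurd hv (h.hereditary.source_first_notMem₁ α)
  | ofF₂ α => exact absurd hv (h.source_first_notMem₂ α)

/-- The partial injection `Step e` is defined on all p that start at r(e). This is what makes e^* e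
act as r(e) in the representation. -/
theorem exists_step_of_src (h : E.IsAdmissiblePair H S) (hp : p.src = E.r e) :
    ∃ q, Step e p q := by
  by_cases hs : E.s e ∈ H
  · obtain rfl := eq_ofH_of_src_mem h hp (h.hereditary e hs)
    exact ⟨_, .ofH _ ⟨_, hs⟩ rfl rfl⟩
  by_cases hs' : E.s e ∈ S ∧ E.r e ∈ H
  · obtain rfl := eq_ofH_of_src_mem h hp hs'.2
    exact ⟨_, .ofS _ ⟨_, hs'.1⟩ rfl rfl⟩
  · obtain ⟨q, hq⟩ := exists_cons_of_src hp hs fun h₁ h₂ => hs' ⟨h₁, h₂⟩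
    exact ⟨q, .cons hq⟩

end HSVertex

end DirGraph

/-! ### Arrows and coefficients in L_R(_HE_S) -/

namespace DirGraph

open LeavittPathAlgebra

variable {V W : Type*} {E : DirGraph V W} {H S : Set V}

namespace HSVertex

variable (R : Type*) [CommRing R] (h : E.IsAdmissiblePair H S)

/-- The generator of the right ideal of `L_R(_HE_S)` belonging to a vertex `p`: the vertex itself if
it lies in `H` or `S`, and the edge `bar α` if `p` is a path `α`. -/
noncomputable def arrow :
    E.HSVertex H S → LeavittPathAlgebra R (E.hsGraph H S h.hereditary)
  | ofH v => vertex R _ (ofH v)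
  | ofS v => vertex R _ (ofS v)
  | ofF₁ α => edge R _ (.bar₁ α)
  | ofF₂ α => edge R _ (.bar₂ α)

open Classical in
/-- The coefficient in `L_R(_HE_S)` of left multiplication by `e` from the summand of `p` to that
of `q`. -/
noncomputable def coef (e : W) :
    E.HSVertex H S → E.HSVertex H S → LeavittPathAlgebra R (E.hsGraph H S h.hereditary)
  | ofH _, ofH _ => if hs : E.s e ∈ H then edge R _ (.ofH e hs) else 0
  | ofH _, ofS _ =>
    if hs : E.s e ∈ S ∧ E.r e ∈ H then edge R _ (.ofS e hs.1 hs.2) else 0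
  -- This case serves the prepending of an edge to a path, which leaves the range unchanged. Pairs
  -- not related by `Step e` get irrelevant values, since coefficients are only used along steps.
  | p, _ => vertex R _ p.base

theorem coef_ofH {e : W} (hs : E.s e ∈ H) (v w : H) :
    coef R h e (ofH v) (ofH w) = edge R _ (.ofH e hs) := dif_pos hs

theorem coef_ofS {e : W} (hs : E.s e ∈ S) (hr : E.r e ∈ H) (v : H) (w : S) :
    coef R h e (ofH v) (ofS w) = edge R _ (.ofS e hs hr) := dif_pos ⟨hs, hr⟩

variable {R h} {e f : W} {p p' q q' : E.HSVertex H S}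

theorem coef_cons (hc : Cons e p q) : coef R h e p q = vertex R _ p.base := by
  cases hc <;> rfl

theorem arrow_base (p : E.HSVertex H S) : arrow R h p.base = vertex R _ p.base := by
  cases p <;> rfl

theorem vertex_mul_arrow (p : E.HSVertex H S) : vertex R _ p * arrow R h p = arrow R h p := by
  cases p with
  | ofH v => exact vertex_mul_self _
  | ofS v => exact vertex_mul_self _
  | ofF₁ α => exact vertex_mul_edge (E := E.hsGraph H S h.hereditary) (HSEdge.bar₁ α)
  | ofF₂ α => exact vertex_mul_edge (E := E.hsGraph H S h.hereditary) (HSEdge.bar₂ α)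

theorem arrow_mul_vertex (p : E.HSVertex H S) :
    arrow R h p * vertex R _ p.base = arrow R h p := by
  cases p with
  | ofH v => exact vertex_mul_self _
  | ofS v => exact vertex_mul_self _
  | ofF₁ α => exact edge_mul_vertex (E := E.hsGraph H S h.hereditary) (HSEdge.bar₁ α)
  | ofF₂ α => exact edge_mul_vertex (E := E.hsGraph H S h.hereditary) (HSEdge.bar₂ α)

theorem star_arrow_mul_arrow_self (p : E.HSVertex H S) :
    star (arrow R h p) * arrow R h p = vertex R _ p.base := by
  cases p with
  | ofH v => simp only [arrow, star_vertex, vertex_mul_self, base]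
  | ofS v => simp only [arrow, star_vertex, vertex_mul_self, base]
  | ofF₁ α =>
    simp only [arrow, star_edge]
    exact ghost_mul_edge (E := E.hsGraph H S h.hereditary) (HSEdge.bar₁ α)
  | ofF₂ α =>
    simp only [arrow, star_edge]
    exact ghost_mul_edge (E := E.hsGraph H S h.hereditary) (HSEdge.bar₂ α)

theorem star_arrow_mul_arrow_of_ne (hpq : p ≠ q) : star (arrow R h p) * arrow R h q = 0 := by
  rw [← vertex_mul_arrow p, ← vertex_mul_arrow q, star_mul, mul_assoc, star_vertex,
    ← mul_assoc (vertex _ _ _), vertex_mul_of_ne hpq, zero_mul, mul_zero]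

/-- A path α, as a vertex of _HE_S, emits only the edge bar α, so the last Leavitt relation has a
single term. With `star_arrow_mul_arrow_self`, left multiplication by `arrow p` identifies the right
ideals of r(p) and of p. -/
theorem arrow_mul_star_arrow (p : E.HSVertex H S) :
    arrow R h p * star (arrow R h p) = vertex R _ p := by
  cases p with
  | ofH v => simp only [arrow, star_vertex, vertex_mul_self]
  | ofS v => simp only [arrow, star_vertex, vertex_mul_self]
  | ofF₁ α =>
    have := (isLeavittFamily R (E.hsGraph H S h.hereditary)).ck2 (ofF₁ α) {.bar₁ α}
      (fun ε => by cases ε <;> simp [hsGraph]) (by simp)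
    rw [this, Finset.sum_singleton, arrow, star_edge]
  | ofF₂ α =>
    have := (isLeavittFamily R (E.hsGraph H S h.hereditary)).ck2 (ofF₂ α) {.bar₂ α}
      (fun ε => by cases ε <;> simp [hsGraph]) (by simp)
    rw [this, Finset.sum_singleton, arrow, star_edge]

theorem vertex_mul_coef (hc : Step e p q) :
    vertex R _ q.base * coef R h e p q = coef R h e p q := by
  cases hc with
  | ofH v w hv hw =>
    obtain ⟨v, hv'⟩ := v
    obtain ⟨w, hw'⟩ := w
    subst hv hw
    rw [coef_ofH R h hw']
    exact vertex_mul_edge (E := E.hsGraph H S h.hereditary) (HSEdge.ofH e hw')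
  | ofS v w hv hw =>
    obtain ⟨v, hv'⟩ := v
    obtain ⟨w, hw'⟩ := w
    subst hv hw
    rw [coef_ofS R h hw' hv']
    exact vertex_mul_edge (E := E.hsGraph H S h.hereditary) (HSEdge.ofS e hw' hv')
  | cons hc => rw [coef_cons hc, hc.base_eq, vertex_mul_self]

theorem coef_mul_vertex (hc : Step e p q) :
    coef R h e p q * vertex R _ p.base = coef R h e p q := by
  cases hc with
  | ofH v w hv hw =>
    obtain ⟨v, hv'⟩ := v
    obtain ⟨w, hw'⟩ := w
    subst hv hw
    rw [coef_ofH R h hw']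
    exact edge_mul_vertex (E := E.hsGraph H S h.hereditary) (HSEdge.ofH e hw')
  | ofS v w hv hw =>
    obtain ⟨v, hv'⟩ := v
    obtain ⟨w, hw'⟩ := w
    subst hv hw
    rw [coef_ofS R h hw' hv']
    exact edge_mul_vertex (E := E.hsGraph H S h.hereditary) (HSEdge.ofS e hw' hv')
  | cons hc => rw [coef_cons hc, vertex_mul_self]

theorem star_coef_mul_vertex (hc : Step e p q) :
    star (coef R h e p q) * vertex R _ q.base = star (coef R h e p q) := by
  simpa using congrArg star (vertex_mul_coef (R := R) (h := h) hc)

theorem vertex_mul_star_coef (hc : Step e p q) :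
    vertex R _ p.base * star (coef R h e p q) = star (coef R h e p q) := by
  simpa using congrArg star (coef_mul_vertex (R := R) (h := h) hc)

theorem star_coef_mul_coef (hc : Step e p q) :
    star (coef R h e p q) * coef R h e p q = vertex R _ p.base := by
  cases hc with
  | ofH v w hv hw =>
    obtain ⟨v, hv'⟩ := v
    obtain ⟨w, hw'⟩ := w
    subst hv hw
    rw [coef_ofH R h hw', star_edge]
    exact ghost_mul_edge (E := E.hsGraph H S h.hereditary) (HSEdge.ofH e hw')
  | ofS v w hv hw =>
    obtain ⟨v, hv'⟩ := v
    obtain ⟨w, hw'⟩ := w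
    subst hv hw
    rw [coef_ofS R h hw' hv', star_edge]
    exact ghost_mul_edge (E := E.hsGraph H S h.hereditary) (HSEdge.ofS e hw' hv')
  | cons hc => rw [coef_cons hc, star_vertex, vertex_mul_self]

/-- Inside H and S this is the orthogonality of distinct edges of _HE_S. A path q, on the other
hand, determines its first edge, so it cannot be reached by two different edges. -/
theorem star_coef_mul_coef_of_ne (hef : e ≠ f) (hc : Step e p q) (hc' : Step f p' q) :
    star (coef R h e p q) * coef R h f p' q = 0 := by
  cases hc with
  | ofH v w hv hw =>
    cases hc' with
    | ofH v' _ hv' hw' =>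
      rw [coef_ofH R h (hw ▸ w.2), coef_ofH R h (hw' ▸ w.2), star_edge]
      exact ghost_mul_edge_of_ne fun h => hef (HSEdge.ofH.inj h)
    | cons hc' => cases hc'
  | ofS v w hv hw =>
    cases hc' with
    | ofS v' _ hv' hw' =>
      rw [coef_ofS R h (hw ▸ w.2) (hv ▸ v.2), coef_ofS R h (hw' ▸ w.2) (hv' ▸ v'.2), star_edge]
      exact ghost_mul_edge_of_ne fun h => hef (HSEdge.ofS.inj h)
    | cons hc' => cases hc'
  | cons hc =>
    cases hc' with
    | ofH v' _ hv' hw' => cases hc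
    | ofS v' _ hv' hw' => cases hc
    | cons hc' => exact absurd (hc.left_unique hc').1 hef

end HSVertex

open HSVertex

/-! ### Breaking elements -/

theorem IsAdmissiblePair.finite_range_notMem (h : E.IsAdmissiblePair H S) {v : V} (hv : v ∈ S) :
    {e | E.s e = v ∧ E.r e ∉ H}.Finite := (h.subset hv).2.2.2

section Breaking

variable {R : Type*} [CommRing R]

theorem breakingElement_eq (h : E.IsAdmissiblePair H S) {v : V} (hv : v ∈ S) :
    E.breakingElement R H v =
      vertex R E v - ∑ e ∈ (h.finite_range_notMem hv).toFinset, edge R E e * ghost R E e := by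
  rw [breakingElement, finsum_mem_eq_finite_toFinset_sum _ (h.finite_range_notMem hv)]

theorem star_breakingElement (h : E.IsAdmissiblePair H S) {v : V} (hv : v ∈ S) :
    star (E.breakingElement R H v) = E.breakingElement R H v := by
  rw [breakingElement_eq h hv, star_sub, star_sum, star_vertex]
  congr 1
  exact Finset.sum_congr rfl fun e _ => by rw [star_mul, star_edge, star_ghost]

/-- The element v^H kills the edges from v that stay outside H and, by the next lemma, fixes those
that enter H. These two facts are all that is needed about v^H later on, and they also make it
idempotent. -/
theorem breakingElement_mul_edge_of_notMem (h : E.IsAdmissiblePair H S) {e : W}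
    (hs : E.s e ∈ S) (hr : E.r e ∉ H) : E.breakingElement R H (E.s e) * edge R E e = 0 := by
  rw [breakingElement_eq h hs, sub_mul, vertex_mul_edge, Finset.sum_mul,
    Finset.sum_eq_single_of_mem e (by simp [hr]), mul_assoc, ghost_mul_edge, edge_mul_vertex,
    sub_self]
  intro f _ hf
  rw [mul_assoc, ghost_mul_edge_of_ne hf, mul_zero]

theorem breakingElement_mul_edge_of_mem (h : E.IsAdmissiblePair H S) {e : W}
    (hs : E.s e ∈ S) (hr : E.r e ∈ H) :
    E.breakingElement R H (E.s e) * edge R E e = edge R E e := by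
  rw [breakingElement_eq h hs, sub_mul, vertex_mul_edge, Finset.sum_mul, Finset.sum_eq_zero,
    sub_zero]
  intro f hf
  rw [mul_assoc, ghost_mul_edge_of_ne, mul_zero]
  rintro rfl
  simp at hf
  exact hf hr

theorem vertex_mul_breakingElement (h : E.IsAdmissiblePair H S) {v : V} (hv : v ∈ S) :
    vertex R E v * E.breakingElement R H v = E.breakingElement R H v := by
  rw [breakingElement_eq h hv, mul_sub, vertex_mul_self, Finset.mul_sum]
  congr 1
  refine Finset.sum_congr rfl fun e he => ?_
  obtain ⟨rfl, -⟩ : E.s e = v ∧ E.r e ∉ H := by simpa using he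
  rw [← mul_assoc, vertex_mul_edge]

theorem breakingElement_mul_vertex (h : E.IsAdmissiblePair H S) {v : V} (hv : v ∈ S) :
    E.breakingElement R H v * vertex R E v = E.breakingElement R H v := by
  simpa [star_breakingElement h hv] using congrArg star (vertex_mul_breakingElement (R := R) h hv)

theorem breakingElement_mul_self (h : E.IsAdmissiblePair H S) {v : V} (hv : v ∈ S) :
    E.breakingElement R H v * E.breakingElement R H v = E.breakingElement R H v := by
  nth_rw 2 [breakingElement_eq h hv]
  rw [mul_sub, breakingElement_mul_vertex h hv, Finset.mul_sum, Finset.sum_eq_zero, sub_zero]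
  intro e he
  obtain ⟨rfl, hr⟩ : E.s e = v ∧ E.r e ∉ H := by simpa using he
  rw [← mul_assoc, breakingElement_mul_edge_of_notMem h hv hr, zero_mul]

end Breaking

/-! ### Orthogonality in L_R(E) of the elements attached to vertices of _HE_S -/

namespace HSVertex

variable (R : Type*) [CommRing R]

/-- The element of `L_R(E)` corresponding to `arrow p`. -/
noncomputable def toLPA : E.HSVertex H S → LeavittPathAlgebra R E
  | ofH v => vertex R E v
  | ofS v => E.breakingElement R H v
  | ofF₁ α => α.1.edges.foldr (fun e x => edge R E e * x) (vertex R E (E.r α.1.last))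
  | ofF₂ α => α.1.edges.foldr (fun e x => edge R E e * x) (E.breakingElement R H (E.r α.1.last))

variable {R} {e f : W} {p p' q q' : E.HSVertex H S}

theorem toLPA_cons (hc : Cons e p q) : toLPA R q = edge R E e * toLPA R p := by
  cases hc with
  | single₁ v α hv hα =>
    simp only [toLPA, PosPath.last_eq_of_singleton hα, hα, hv, List.foldr_cons, List.foldr_nil]
  | single₂ v α hv hα =>
    simp only [toLPA, PosPath.last_eq_of_singleton hα, hα, hv, List.foldr_cons, List.foldr_nil]
  | cons₁ α β hα => simp only [toLPA, PosPath.last_eq_of_cons hα, hα, List.foldr_cons]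
  | cons₂ α β hα => simp only [toLPA, PosPath.last_eq_of_cons hα, hα, List.foldr_cons]

theorem vertex_mul_toLPA (h : E.IsAdmissiblePair H S) (p : E.HSVertex H S) :
    vertex R E p.src * toLPA R p = toLPA R p := by
  induction p using cons_induction with
  | ofH v => exact vertex_mul_self _
  | ofS v => exact vertex_mul_breakingElement h v.2
  | cons e p q hc _ => rw [toLPA_cons hc, hc.src_right, ← mul_assoc, vertex_mul_edge]

theorem vertex_mul_toLPA_of_ne (h : E.IsAdmissiblePair H S) {v : V} (hv : v ≠ p.src) :
    vertex R E v * toLPA R p = 0 := by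
  rw [← vertex_mul_toLPA h, ← mul_assoc, vertex_mul_of_ne hv, zero_mul]

theorem edge_mul_toLPA_of_ne (h : E.IsAdmissiblePair H S) (he : E.r e ≠ p.src) :
    edge R E e * toLPA R p = 0 := by
  rw [← vertex_mul_toLPA h, ← mul_assoc, edge_mul_vertex_of_ne he, zero_mul]

theorem ghost_mul_toLPA_of_ne (h : E.IsAdmissiblePair H S) (he : E.s e ≠ p.src) :
    ghost R E e * toLPA R p = 0 := by
  rw [← vertex_mul_toLPA h, ← mul_assoc, ghost_mul_vertex_of_ne he, zero_mul]

theorem star_toLPA_base (h : E.IsAdmissiblePair H S) (p : E.HSVertex H S) :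
    star (toLPA R p.base) = toLPA R p.base := by
  cases p with
  | ofH v => exact star_vertex _
  | ofS v => exact star_breakingElement h v.2
  | ofF₁ α => exact star_vertex _
  | ofF₂ α => exact star_breakingElement h α.2

theorem toLPA_base_mul_self (h : E.IsAdmissiblePair H S) (p : E.HSVertex H S) :
    toLPA R p.base * toLPA R p.base = toLPA R p.base := by
  cases p with
  | ofH v => exact vertex_mul_self _
  | ofS v => exact breakingElement_mul_self h v.2
  | ofF₁ α => exact vertex_mul_self _
  | ofF₂ α => exact breakingElement_mul_self h α.2

theorem toLPA_mul_base (h : E.IsAdmissiblePair H S) (p : E.HSVertex H S) :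
    toLPA R p * toLPA R p.base = toLPA R p := by
  induction p using cons_induction with
  | ofH v => exact vertex_mul_self _
  | ofS v => exact breakingElement_mul_self h v.2
  | cons e p q hc ih => rw [toLPA_cons hc, hc.base_eq, mul_assoc, ih]

theorem toLPA_ofH_mul_of_ne (h : E.IsAdmissiblePair H S) {v : H} (hq : ofH v ≠ q) :
    vertex R E v * toLPA R q = 0 := by
  refine vertex_mul_toLPA_of_ne h fun hv => hq ?_
  exact (eq_ofH_of_src_mem h hv.symm v.2).symm

/-- Either the path starts at another vertex, or its first edge leaves v without entering H and is
killed by v^H. -/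
theorem toLPA_ofS_mul_cons (h : E.IsAdmissiblePair H S) (v : S) (hc : Cons e p q) :
    E.breakingElement R H v * toLPA R q = 0 := by
  rw [toLPA_cons hc, ← mul_assoc]
  by_cases hv : v = E.s e
  · have hs : E.s e ∈ S := hv ▸ v.2
    rw [hv, breakingElement_mul_edge_of_notMem h hs (hc.range_notMem h hs), zero_mul]
  · rw [← breakingElement_mul_vertex h v.2, mul_assoc _ _ (edge _ _ _), vertex_mul_edge_of_ne hv,
      mul_zero, zero_mul]

theorem star_toLPA_mul_toLPA_self (h : E.IsAdmissiblePair H S) (p : E.HSVertex H S) :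
    star (toLPA R p) * toLPA R p = toLPA R p.base := by
  induction p using cons_induction with
  | ofH v => rw [toLPA, star_vertex, vertex_mul_self]; rfl
  | ofS v => rw [toLPA, star_breakingElement h v.2, breakingElement_mul_self h v.2]; rfl
  | cons e p q hc ih =>
    rw [toLPA_cons hc, star_mul, mul_assoc, star_edge, ← mul_assoc (ghost _ _ _), ghost_mul_edge,
      ← hc.src_left, vertex_mul_toLPA h, ih, hc.base_eq]

/-- Common first edges cancel. Then either the first edges differ, or one path is exhausted at a
vertex of H or S and annihilates the other. The involution exchanges the two roles. -/
theorem star_toLPA_mul_toLPA_of_ne (h : E.IsAdmissiblePair H S) (hpq : p ≠ q) :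
    star (toLPA R p) * toLPA R q = 0 := by
  induction p using cons_induction generalizing q with
  | ofH v => rw [toLPA, star_vertex, toLPA_ofH_mul_of_ne h hpq]
  | ofS v =>
    rw [toLPA, star_breakingElement h v.2]
    induction q using cons_induction with
    | ofH w =>
      rw [← star_breakingElement h v.2]
      apply star_injective
      rw [star_mul, star_star, star_zero, toLPA, star_vertex]
      exact toLPA_ofH_mul_of_ne h hpq.symm
    | ofS w =>
      rw [toLPA, ← breakingElement_mul_vertex h v.2, ← vertex_mul_breakingElement h w.2, mul_assoc,
        ← mul_assoc (vertex _ _ _), vertex_mul_of_ne, zero_mul, mul_zero]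
      exact fun hvw => hpq (congrArg ofS (Subtype.ext hvw))
    | cons e p q hc _ => exact toLPA_ofS_mul_cons h v hc
  | cons e p p' hc ih =>
    induction q using cons_induction with
    | ofH w =>
      apply star_injective
      rw [star_mul, star_star, star_zero, toLPA, star_vertex]
      exact toLPA_ofH_mul_of_ne h hpq.symm
    | ofS w =>
      apply star_injective
      rw [star_mul, star_star, star_zero, toLPA, star_breakingElement h w.2]
      exact toLPA_ofS_mul_cons h w hc
    | cons f q q' hc' _ =>
      rw [toLPA_cons hc, toLPA_cons hc', star_mul, mul_assoc, star_edge, ← mul_assoc (ghost _ _ _)]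
      by_cases hef : e = f
      · subst hef
        rw [ghost_mul_edge, ← hc'.src_left, vertex_mul_toLPA h, ih]
        rintro rfl
        exact hpq (hc.right_unique hc')
      · rw [ghost_mul_edge_of_ne hef, zero_mul, mul_zero]

end HSVertex

end DirGraph

/-! ### The homomorphism from L_R(_HE_S) to L_R(E) -/

namespace DirGraph

open LeavittPathAlgebra HSVertex

variable {V W : Type*} {E : DirGraph V W} {H S : Set V} {R : Type*} [CommRing R]

/-- The involution supplies the ghost relations, and edges with different sources are orthogonal
because their source projections are. -/
theorem IsLeavittFamily.of_star {A : Type*} [NonUnitalRing A] [StarRing A] {a : V → A} {b : W → A}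
    (star_a : ∀ v, star (a v) = a v) (idem : ∀ v, a v * a v = a v)
    (orth : ∀ v w, v ≠ w → a v * a w = 0) (source_edge : ∀ e, a (E.s e) * b e = b e)
    (edge_range : ∀ e, b e * a (E.r e) = b e) (ck1_same : ∀ e, star (b e) * b e = a (E.r e))
    (ck1_ne : ∀ e f, e ≠ f → E.s e = E.s f → star (b e) * b f = 0)
    (ck2 : ∀ (v : V) (F : Finset W), (∀ e, e ∈ F ↔ E.s e = v) → F.Nonempty →
      a v = ∑ e ∈ F, b e * star (b e)) :
    E.IsLeavittFamily a b fun e => star (b e) where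
  idem := idem
  orth := orth
  source_edge := source_edge
  edge_range := edge_range
  range_ghost e := by simpa [star_a] using congrArg star (edge_range e)
  ghost_source e := by simpa [star_a] using congrArg star (source_edge e)
  ck1_same := ck1_same
  ck1_ne e f hef := by
    by_cases h : E.s e = E.s f
    · exact ck1_ne e f hef h
    · rw [← source_edge e, ← source_edge f, star_mul, star_a, mul_assoc, ← mul_assoc (a _),
        orth _ _ h, zero_mul, mul_zero]
  ck2 := ck2

/-- The element of `L_R(E)` corresponding to an edge of `_HE_S`. -/
noncomputable def HSEdge.toLPA (R : Type*) [CommRing R] :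
    E.HSEdge H S → LeavittPathAlgebra R E
  | .ofH e _ => edge R E e
  | .ofS e _ _ => edge R E e
  | .bar₁ α => HSVertex.toLPA R (ofF₁ α)
  | .bar₂ α => HSVertex.toLPA R (ofF₂ (H := H) α)

theorem HSVertex.toLPA_mul_star_of_base (h : E.IsAdmissiblePair H S) {p : E.HSVertex H S}
    (hp : p.base = p) : p.toLPA R * star (p.toLPA R) = p.toLPA R := by
  rw [← hp, star_toLPA_base h, toLPA_base_mul_self h]

theorem HSEdge.source_mul_toLPA (h : E.IsAdmissiblePair H S) (ε : E.HSEdge H S) :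
    ((E.hsGraph H S h.hereditary).s ε).toLPA R * star (((E.hsGraph H S h.hereditary).s ε).toLPA R) *
      ε.toLPA R = ε.toLPA R := by
  cases ε with
  | ofH e hs =>
    rw [toLPA_mul_star_of_base h rfl]
    exact vertex_mul_edge e
  | ofS e hs hr =>
    rw [toLPA_mul_star_of_base h rfl]
    exact breakingElement_mul_edge_of_mem h hs hr
  | bar₁ α =>
    refine (mul_assoc _ _ _).trans ((congrArg _ (star_toLPA_mul_toLPA_self (R := R) h (ofF₁ α))).trans ?_)
    exact toLPA_mul_base (R := R) h (ofF₁ α)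
  | bar₂ α =>
    refine (mul_assoc _ _ _).trans ((congrArg _ (star_toLPA_mul_toLPA_self (R := R) h (ofF₂ α))).trans ?_)
    exact toLPA_mul_base (R := R) h (ofF₂ α)

theorem base_hsGraph_r (h : E.IsAdmissiblePair H S) (ε : E.HSEdge H S) :
    ((E.hsGraph H S h.hereditary).r ε).base = (E.hsGraph H S h.hereditary).r ε := by
  cases ε <;> rfl

theorem HSEdge.toLPA_mul_range (h : E.IsAdmissiblePair H S) (ε : E.HSEdge H S) :
    ε.toLPA R * ((E.hsGraph H S h.hereditary).r ε).toLPA R = ε.toLPA R := by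
  cases ε with
  | ofH e hs => exact edge_mul_vertex (R := R) e
  | ofS e hs hr => exact edge_mul_vertex (R := R) e
  | bar₁ α => exact toLPA_mul_base (R := R) h (ofF₁ α)
  | bar₂ α => exact toLPA_mul_base (R := R) h (ofF₂ α)

theorem HSEdge.star_toLPA_mul_toLPA_self (h : E.IsAdmissiblePair H S) (ε : E.HSEdge H S) :
    star (ε.toLPA R) * ε.toLPA R = ((E.hsGraph H S h.hereditary).r ε).toLPA R := by
  cases ε with
  | ofH e hs => exact (congrArg (· * _) (star_edge (R := R) e)).trans (ghost_mul_edge e)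
  | ofS e hs hr => exact (congrArg (· * _) (star_edge (R := R) e)).trans (ghost_mul_edge e)
  | bar₁ α => exact HSVertex.star_toLPA_mul_toLPA_self (R := R) h (ofF₁ α)
  | bar₂ α => exact HSVertex.star_toLPA_mul_toLPA_self (R := R) h (ofF₂ α)

theorem HSEdge.star_toLPA_mul_toLPA_of_ne (h : E.IsAdmissiblePair H S) {ε ε' : E.HSEdge H S}
    (hne : ε ≠ ε') (hs : (E.hsGraph H S h.hereditary).s ε = (E.hsGraph H S h.hereditary).s ε') :
    star (ε.toLPA R) * ε'.toLPA R = 0 := by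
  cases ε with
  | ofH e he =>
    cases ε' with
    | ofH f hf =>
      refine (congrArg (· * _) (star_edge (R := R) e)).trans (ghost_mul_edge_of_ne ?_)
      rintro rfl
      exact hne rfl
    | _ => cases hs
  | ofS e he he' =>
    cases ε' with
    | ofS f hf hf' =>
      refine (congrArg (· * _) (star_edge (R := R) e)).trans (ghost_mul_edge_of_ne ?_)
      rintro rfl
      exact hne rfl
    | _ => cases hs
  | bar₁ α =>
    cases ε' with
    | bar₁ β => exact absurd (congrArg _ (ofF₁.inj hs)) hne
    | _ => cases hs
  | bar₂ α =>
    cases ε' with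
    | bar₂ β => exact absurd (congrArg _ (ofF₂.inj hs)) hne
    | _ => cases hs

theorem IsAdmissiblePair.infinite_range_mem (h : E.IsAdmissiblePair H S) {v : V} (hv : v ∈ S) :
    {e | E.s e = v ∧ E.r e ∈ H}.Infinite := by
  intro hfin
  refine (h.subset hv).2.1 ((hfin.union (h.finite_range_notMem hv)).subset fun e he => ?_)
  by_cases hr : E.r e ∈ H
  · exact Or.inl ⟨he, hr⟩
  · exact Or.inr ⟨he, hr⟩

/-- A vertex of H emits the same edges in _HE_S as in E, a vertex of S still emits infinitely many,
so that nothing is required there, and a path emits one edge. -/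
theorem toLPA_mul_star_eq_sum (h : E.IsAdmissiblePair H S) (p : E.HSVertex H S)
    (F : Finset (E.HSEdge H S)) (hF : ∀ ε, ε ∈ F ↔ (E.hsGraph H S h.hereditary).s ε = p)
    (hne : F.Nonempty) :
    p.toLPA R * star (p.toLPA R) = ∑ ε ∈ F, ε.toLPA R * star (ε.toLPA R) := by
  classical
  -- The underlying edge of E. The values on the edges bar α are arbitrary, since `u` is used only
  -- for edges out of H or S.
  let u : E.HSEdge H S → W := fun
    | .ofH e _ => e
    | .ofS e _ _ => e
    | .bar₁ α => α.1.last
    | .bar₂ α => α.1.last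
  cases p with
  | ofH v =>
    rw [toLPA_mul_star_of_base h rfl]
    have hmem : ∀ e, e ∈ F.image u ↔ E.s e = v := by
      intro e
      rw [Finset.mem_image]
      constructor
      · rintro ⟨ε, hε, rfl⟩
        rw [hF] at hε
        cases ε with
        | ofH e hs => exact congrArg Subtype.val (ofH.inj hε)
        | _ => cases hε
      · rintro he
        refine ⟨.ofH e (he ▸ v.2), (hF _).2 (congrArg ofH (Subtype.ext he)), rfl⟩
    have hinj : Set.InjOn u F := by
      intro ε hε ε' hε' huu
      rw [Finset.mem_coe, hF] at hε hε'
      cases ε with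
      | ofH e hs =>
        cases ε' with
        | ofH f hf =>
          obtain rfl : e = f := huu
          rfl
        | _ => cases hε'
      | _ => cases hε
    refine ((isLeavittFamily R E).ck2 v (F.image u) hmem (hne.image u)).trans ?_
    rw [Finset.sum_image hinj]
    refine Finset.sum_congr rfl fun ε hε => ?_
    rw [hF] at hε
    cases ε with
    | ofH e hs => exact congrArg (_ * ·) (star_edge (R := R) e).symm
    | _ => cases hε
  | ofS v =>
    refine absurd ((F.image u).finite_toSet.subset fun e he => ?_) (h.infinite_range_mem v.2)
    obtain ⟨hs, hr⟩ := he
    exact Finset.mem_coe.2 (Finset.mem_image.2 ⟨.ofS e (hs ▸ v.2) hr,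
      (hF _).2 (congrArg ofS (Subtype.ext hs)), rfl⟩)
  | ofF₁ α =>
    have : F = {.bar₁ α} := by
      ext ε
      rw [hF, Finset.mem_singleton]
      cases ε <;> simp [hsGraph]
    rw [this, Finset.sum_singleton]
    rfl
  | ofF₂ α =>
    have : F = {.bar₂ α} := by
      ext ε
      rw [hF, Finset.mem_singleton]
      cases ε <;> simp [hsGraph]
    rw [this, Finset.sum_singleton]
    rfl

theorem isLeavittFamily_toLPA (h : E.IsAdmissiblePair H S) :
    (E.hsGraph H S h.hereditary).IsLeavittFamily
      (fun p => p.toLPA R * star (p.toLPA R)) (fun ε => ε.toLPA R) fun ε => star (ε.toLPA R) := by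
  apply IsLeavittFamily.of_star
  · intro p; rw [star_mul, star_star]
  · intro p
    rw [mul_assoc, ← mul_assoc (star _), star_toLPA_mul_toLPA_self h, ← mul_assoc,
      toLPA_mul_base h]
  · intro p q hpq
    rw [mul_assoc, ← mul_assoc (star _), star_toLPA_mul_toLPA_of_ne h hpq, zero_mul, mul_zero]
  · exact HSEdge.source_mul_toLPA h
  · intro ε
    rw [toLPA_mul_star_of_base h (base_hsGraph_r h ε), HSEdge.toLPA_mul_range h]
  · intro ε
    rw [toLPA_mul_star_of_base h (base_hsGraph_r h ε), HSEdge.star_toLPA_mul_toLPA_self h]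
  · exact fun ε ε' hne hs => HSEdge.star_toLPA_mul_toLPA_of_ne h hne hs
  · exact toLPA_mul_star_eq_sum h

/-- The homomorphism `L_R(_HE_S) → L_R(E)`. -/
noncomputable def hsHom (R : Type*) [CommRing R] (h : E.IsAdmissiblePair H S) :
    LeavittPathAlgebra R (E.hsGraph H S h.hereditary) →ₙₐ[R] LeavittPathAlgebra R E :=
  (existsUnique_hom (isLeavittFamily_toLPA h)).choose

variable (h : E.IsAdmissiblePair H S)

theorem hsHom_vertex (p : E.HSVertex H S) :
    hsHom R h (vertex R _ p) = p.toLPA R * star (p.toLPA R) :=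
  (existsUnique_hom (isLeavittFamily_toLPA h)).choose_spec.1.1 p

theorem hsHom_edge (ε : E.HSEdge H S) : hsHom R h (edge R _ ε) = ε.toLPA R :=
  (existsUnique_hom (isLeavittFamily_toLPA h)).choose_spec.1.2.1 ε

theorem hsHom_ghost (ε : E.HSEdge H S) : hsHom R h (ghost R _ ε) = star (ε.toLPA R) :=
  (existsUnique_hom (isLeavittFamily_toLPA h)).choose_spec.1.2.2 ε

theorem hsHom_star (x : LeavittPathAlgebra R (E.hsGraph H S h.hereditary)) :
    hsHom R h (star x) = star (hsHom R h x) := by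
  induction x using LeavittPathAlgebra.induction with
  | hv p => simp [hsHom_vertex]
  | he ε => simp [hsHom_edge, hsHom_ghost]
  | hg ε => simp [hsHom_edge, hsHom_ghost]
  | zero => simp
  | add x y hx hy => simp [hx, hy]
  | mul x y hx hy => simp [hx, hy]
  | smul k x hx => simp [hx, star_smul']

theorem hsHom_vertex_base (p : E.HSVertex H S) :
    hsHom R h (vertex R _ p.base) = p.base.toLPA R := by
  rw [hsHom_vertex, toLPA_mul_star_of_base h (base_base p)]

theorem hsHom_arrow (p : E.HSVertex H S) : hsHom R h (arrow R h p) = p.toLPA R := by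
  cases p with
  | ofH v => exact hsHom_vertex_base h (ofH v)
  | ofS v => exact hsHom_vertex_base h (ofS v)
  | ofF₁ α => exact hsHom_edge h _
  | ofF₂ α => exact hsHom_edge h _

/-! ### The range of the homomorphism -/

variable {h} {e : W} {p q : E.HSVertex H S}

/-- These formulas show that the range is closed under left multiplication, and they are the model
for the operators of the representation below. -/
theorem HSVertex.Step.edge_mul_toLPA (hc : Step e p q) :
    edge R E e * p.toLPA R = q.toLPA R * hsHom R h (coef R h e p q) := by
  cases hc with
  | ofH v w hv hw =>
    obtain ⟨v, hv'⟩ := v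
    obtain ⟨w, hw'⟩ := w
    subst hv hw
    rw [coef_ofH R h hw', hsHom_edge]
    exact (edge_mul_vertex (R := R) e).trans (vertex_mul_edge (R := R) e).symm
  | ofS v w hv hw =>
    obtain ⟨v, hv'⟩ := v
    obtain ⟨w, hw'⟩ := w
    subst hv hw
    rw [coef_ofS R h hw' hv', hsHom_edge]
    exact (edge_mul_vertex (R := R) e).trans (breakingElement_mul_edge_of_mem (R := R) h hw' hv').symm
  | cons hc => rw [coef_cons hc, hsHom_vertex_base, ← hc.base_eq, toLPA_mul_base h, toLPA_cons hc]

theorem HSVertex.Step.ghost_mul_toLPA (hc : Step e p q) :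
    ghost R E e * q.toLPA R = p.toLPA R * hsHom R h (star (coef R h e p q)) := by
  rw [hsHom_star]
  cases hc with
  | ofH v w hv hw =>
    obtain ⟨v, hv'⟩ := v
    obtain ⟨w, hw'⟩ := w
    subst hv hw
    rw [coef_ofH R h hw', hsHom_edge]
    apply star_injective
    simp [HSVertex.toLPA, HSEdge.toLPA]
  | ofS v w hv hw =>
    obtain ⟨v, hv'⟩ := v
    obtain ⟨w, hw'⟩ := w
    subst hv hw
    rw [coef_ofS R h hw' hv', hsHom_edge]
    apply star_injective
    simp [HSVertex.toLPA, HSEdge.toLPA, star_breakingElement h hw',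
      breakingElement_mul_edge_of_mem h hw' hv']
  | cons hc =>
    rw [coef_cons hc, hsHom_vertex_base, star_toLPA_base h, toLPA_mul_base h, toLPA_cons hc,
      ← mul_assoc, ghost_mul_edge, ← hc.src_left, vertex_mul_toLPA h]

/-- If e starts where q does, there are two ways to have no step: q is in S and e stays outside H,
so that v^H kills e, or q is a path whose first edge is not e. -/
theorem ghost_mul_toLPA_of_forall_not_step (h : E.IsAdmissiblePair H S)
    (hq : ∀ p : E.HSVertex H S, ¬ Step e p q) : ghost R E e * q.toLPA R = 0 := by
  by_cases hs : E.s e = q.src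
  swap
  · exact ghost_mul_toLPA_of_ne h hs
  induction q using cons_induction with
  | ofH v => exact absurd (.ofH ⟨E.r e, h.hereditary e (hs ▸ v.2)⟩ v rfl hs) (hq _)
  | ofS v =>
    have hr : E.r e ∉ H := fun hr => hq _ (.ofS ⟨E.r e, hr⟩ v rfl hs)
    have hs' : E.s e = v := hs
    apply star_injective
    simp only [star_mul, star_ghost, HSVertex.toLPA, star_breakingElement h v.2, star_zero]
    rw [← hs']
    exact breakingElement_mul_edge_of_notMem h (hs' ▸ v.2) hr
  | cons f p q hc _ =>
    rw [toLPA_cons hc, ← mul_assoc, ghost_mul_edge_of_ne, zero_mul]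
    rintro rfl
    exact hq _ (.cons hc)

theorem mul_hsHom_mem_range (h : E.IsAdmissiblePair H S) (x : LeavittPathAlgebra R E) :
    ∀ z, ∃ z', x * hsHom R h z = hsHom R h z' := by
  -- Since p = `arrow p` times its star in L_R(_HE_S), the image of pz is t_p times an element of
  -- the range, so only products with t_p need checking.
  have of_arrow : ∀ x : LeavittPathAlgebra R E,
      (∀ p : E.HSVertex H S, ∃ z', x * p.toLPA R = hsHom R h z') → ∀ z, ∃ z', x * hsHom R h z = hsHom R h z' := by
    intro x hx z
    induction z using induction_vertex_mul with
    | zero => exact ⟨0, by rw [map_zero, mul_zero]⟩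
    | add z₁ z₂ h₁ h₂ =>
      obtain ⟨y₁, hy₁⟩ := h₁
      obtain ⟨y₂, hy₂⟩ := h₂
      exact ⟨y₁ + y₂, by rw [map_add, map_add, mul_add, hy₁, hy₂]⟩
    | hv p z =>
      obtain ⟨y, hy⟩ := hx p
      refine ⟨y * star (arrow R h p) * z, ?_⟩
      rw [← arrow_mul_star_arrow (h := h), map_mul, map_mul, map_mul, map_mul, hsHom_arrow, ← hy]
      simp only [mul_assoc]
  induction x using LeavittPathAlgebra.induction with
  | hv v =>
    refine of_arrow _ fun p => ?_
    by_cases hv : v = p.src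
    · exact ⟨arrow R h p, by rw [hsHom_arrow, hv, vertex_mul_toLPA h]⟩
    · exact ⟨0, by rw [map_zero, vertex_mul_toLPA_of_ne h hv]⟩
  | he e =>
    refine of_arrow _ fun p => ?_
    by_cases he : E.r e = p.src
    · obtain ⟨q, hc⟩ := exists_step_of_src h he.symm
      exact ⟨arrow R h q * coef R h e p q, by rw [hc.edge_mul_toLPA, map_mul, hsHom_arrow]⟩
    · exact ⟨0, by rw [map_zero, edge_mul_toLPA_of_ne h he]⟩
  | hg e =>
    refine of_arrow _ fun q => ?_
    by_cases hq : ∃ p : E.HSVertex H S, Step e p q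
    · obtain ⟨p, hc⟩ := hq
      exact ⟨arrow R h p * star (coef R h e p q), by
        rw [hc.ghost_mul_toLPA (h := h), map_mul, hsHom_arrow]⟩
    · exact ⟨0, by
        rw [map_zero, ghost_mul_toLPA_of_forall_not_step h fun p hc => hq ⟨p, hc⟩]⟩
  | zero => exact fun z => ⟨0, by rw [map_zero, zero_mul]⟩
  | add x y hx hy =>
    intro z
    obtain ⟨z₁, h₁⟩ := hx z
    obtain ⟨z₂, h₂⟩ := hy z
    exact ⟨z₁ + z₂, by rw [map_add, add_mul, h₁, h₂]⟩
  | mul x y hx hy =>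
    intro z
    obtain ⟨z₁, h₁⟩ := hy z
    obtain ⟨z₂, h₂⟩ := hx z₁
    exact ⟨z₂, by rw [mul_assoc, h₁, h₂]⟩
  | smul k x hx =>
    intro z
    obtain ⟨z₁, h₁⟩ := hx z
    exact ⟨k • z₁, by rw [smul_mul_assoc, h₁, map_smul]⟩

theorem hsHom_mul_mem_range (h : E.IsAdmissiblePair H S) (x : LeavittPathAlgebra R E)
    (z : LeavittPathAlgebra R (E.hsGraph H S h.hereditary)) :
    ∃ z', hsHom R h z * x = hsHom R h z' := by
  obtain ⟨z', hz'⟩ := mul_hsHom_mem_range h (star x) (star z)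
  refine ⟨star z', star_injective ?_⟩
  rw [star_mul, ← hsHom_star, hz', ← hsHom_star, star_star]

theorem toLPA_base_mem_idealOf (p : E.HSVertex H S) : p.base.toLPA R ∈ E.idealOf R H S := by
  apply TwoSidedIdeal.subset_span
  cases p with
  | ofH v => exact Or.inl ⟨v, v.2, rfl⟩
  | ofS v => exact Or.inr ⟨v, v.2, rfl⟩
  | ofF₁ α => exact Or.inl ⟨_, α.2.2, rfl⟩
  | ofF₂ α => exact Or.inr ⟨_, α.2, rfl⟩

theorem hsHom_mem_idealOf (h : E.IsAdmissiblePair H S)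
    (z : LeavittPathAlgebra R (E.hsGraph H S h.hereditary)) :
    hsHom R h z ∈ E.idealOf R H S := by
  induction z using induction_vertex_mul with
  | zero => rw [map_zero]; exact TwoSidedIdeal.zero_mem _
  | add x y hx hy => rw [map_add]; exact TwoSidedIdeal.add_mem _ hx hy
  | hv p z =>
    -- The factor t_{r(p)} made visible here is a generator of the ideal.
    rw [map_mul, hsHom_vertex, ← toLPA_mul_base h]
    exact TwoSidedIdeal.mul_mem_right _ _ _ (TwoSidedIdeal.mul_mem_right _ _ _
      (TwoSidedIdeal.mul_mem_left _ _ _ (toLPA_base_mem_idealOf p)))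

theorem exists_hsHom_eq_of_mem (h : E.IsAdmissiblePair H S) {x : LeavittPathAlgebra R E}
    (hx : x ∈ E.idealOf R H S) : ∃ z, hsHom R h z = x := by
  let J : TwoSidedIdeal (LeavittPathAlgebra R E) := TwoSidedIdeal.mk' (Set.range (hsHom R h))
    ⟨0, map_zero _⟩
    (by rintro _ _ ⟨x, rfl⟩ ⟨y, rfl⟩; exact ⟨x + y, map_add _ _ _⟩)
    (by rintro _ ⟨x, rfl⟩; exact ⟨-x, map_neg _ _⟩)
    (by
      rintro x _ ⟨z, rfl⟩
      obtain ⟨z', hz'⟩ := mul_hsHom_mem_range h x z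
      exact ⟨z', hz'.symm⟩)
    (by
      rintro _ x ⟨z, rfl⟩
      obtain ⟨z', hz'⟩ := hsHom_mul_mem_range h x z
      exact ⟨z', hz'.symm⟩)
  have hJ : E.idealOf R H S ≤ J := by
    refine TwoSidedIdeal.span_le.2 ?_
    rintro _ (⟨v, hv, rfl⟩ | ⟨v, hv, rfl⟩)
    · exact (TwoSidedIdeal.mem_mk' ..).2 ⟨_, hsHom_vertex_base h (ofH ⟨v, hv⟩)⟩
    · exact (TwoSidedIdeal.mem_mk' ..).2 ⟨_, hsHom_vertex_base h (ofS ⟨v, hv⟩)⟩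
  exact (TwoSidedIdeal.mem_mk' (Set.range (hsHom R h)) _ _ _ _ _ x).1 (hJ hx)

end DirGraph

namespace DirGraph

open LeavittPathAlgebra HSVertex

variable {V W : Type*} {E : DirGraph V W} {H S : Set V}

/-! ### A representation of `L_R(E)` by functions into `L_R(_HE_S)` -/

/-- The module of functions from the vertices of `_HE_S` to `L_R(_HE_S)`. -/
abbrev HSModule (R : Type*) [CommRing R] (h : E.IsAdmissiblePair H S) :=
  E.HSVertex H S → LeavittPathAlgebra R (E.hsGraph H S h.hereditary)

section Operators

variable (R : Type*) [CommRing R] (h : E.IsAdmissiblePair H S)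

open Classical in
/-- The operator representing the vertex `v`. -/
noncomputable def vertexOp (v : V) : Module.End R (HSModule R h) where
  toFun g p := if p.src = v then vertex R _ p.base * g p else 0
  map_add' g g' := by
    funext p
    by_cases hp : p.src = v <;> simp [hp, mul_add]
  map_smul' k g := by
    funext p
    by_cases hp : p.src = v <;> simp [hp, mul_smul_comm]

open Classical in
/-- The operator representing the edge `e`. -/
noncomputable def edgeOp (e : W) : Module.End R (HSModule R h) where
  toFun g q := if hq : ∃ p, Step e p q then coef R h e hq.choose q * g hq.choose else 0
  map_add' g g' := by
    funext q
    by_cases hq : ∃ p, Step e p q <;> simp [hq, mul_add]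
  map_smul' k g := by
    funext q
    by_cases hq : ∃ p, Step e p q <;> simp [hq, mul_smul_comm]

open Classical in
/-- The operator representing the ghost edge `e^*`. -/
noncomputable def ghostOp (e : W) : Module.End R (HSModule R h) where
  toFun g p := if hp : ∃ q, Step e p q then star (coef R h e p hp.choose) * g hp.choose else 0
  map_add' g g' := by
    funext p
    by_cases hp : ∃ q, Step e p q <;> simp [hp, mul_add]
  map_smul' k g := by
    funext p
    by_cases hp : ∃ q, Step e p q <;> simp [hp, mul_smul_comm]

end Operators

variable {R : Type*} [CommRing R] {h : E.IsAdmissiblePair H S} {v : V} {e f : W}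
  {p q : E.HSVertex H S}

theorem vertexOp_of_eq (g : HSModule R h) (hp : p.src = v) :
    vertexOp R h v g p = vertex R _ p.base * g p := if_pos hp

theorem vertexOp_of_ne (g : HSModule R h) (hp : p.src ≠ v) : vertexOp R h v g p = 0 := if_neg hp

theorem edgeOp_of_step (g : HSModule R h) (hc : Step e p q) :
    edgeOp R h e g q = coef R h e p q * g p := by
  have hq : ∃ p, Step e p q := ⟨p, hc⟩
  -- At most one p steps to q, so the choice made in the definition is forced.
  obtain rfl := hc.left_unique hq.choose_spec
  exact dif_pos hq

theorem edgeOp_of_forall_not (g : HSModule R h) (hq : ∀ p, ¬ Step e p q) :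
    edgeOp R h e g q = 0 := dif_neg (not_exists.2 hq)

theorem edgeOp_of_ne (g : HSModule R h) (hq : q.src ≠ E.s e) : edgeOp R h e g q = 0 :=
  edgeOp_of_forall_not g fun _ hc => hq hc.src_right

theorem ghostOp_of_step (g : HSModule R h) (hc : Step e p q) :
    ghostOp R h e g p = star (coef R h e p q) * g q := by
  have hp : ∃ q, Step e p q := ⟨q, hc⟩
  obtain rfl := hc.right_unique h hp.choose_spec
  exact dif_pos hp

theorem ghostOp_of_ne (g : HSModule R h) (hp : p.src ≠ E.r e) : ghostOp R h e g p = 0 :=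
  dif_neg fun ⟨_, hc⟩ => hp hc.src_left

theorem edgeOp_ghostOp_of_step (g : HSModule R h) (hc : Step e p q) :
    edgeOp R h e (ghostOp R h e g) q = coef R h e p q * star (coef R h e p q) * g q := by
  rw [edgeOp_of_step _ hc, ghostOp_of_step _ hc, mul_assoc]

open Classical in
-- On the coordinate of a path, f f^* tests whether f is the first edge.
theorem edgeOp_ghostOp_of_cons (g : HSModule R h) (hc : Cons e p q) :
    edgeOp R h f (ghostOp R h f g) q = if f = e then vertex R _ q.base * g q else 0 := by
  split_ifs with hfe
  · subst hfe
    rw [edgeOp_ghostOp_of_step g (.cons hc), coef_cons hc, star_vertex, vertex_mul_self,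
      hc.base_eq]
  · refine edgeOp_of_forall_not _ fun p' hc' => ?_
    cases hc' with
    | ofH _ _ _ _ => cases hc
    | ofS _ _ _ _ => cases hc
    | cons hc' => exact hfe (hc'.left_unique hc).1

theorem sum_edgeOp_ghostOp_of_cons (g : HSModule R h) (hc : Cons e p q) {F : Finset W}
    (he : e ∈ F) : ∑ f ∈ F, edgeOp R h f (ghostOp R h f g) q = vertex R _ q.base * g q := by
  classical
  rw [Finset.sum_congr rfl fun f _ => edgeOp_ghostOp_of_cons g hc, Finset.sum_ite_eq', if_pos he]

/-- At a coordinate in H this is the same relation in L_R(_HE_S); a coordinate in S cannot occur, as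
its vertex emits infinitely many edges; at a path, only the term of its first edge survives. -/
theorem vertexOp_eq_sum (g : HSModule R h) {F : Finset W} (hF : ∀ e, e ∈ F ↔ E.s e = v)
    (hne : F.Nonempty) (q : E.HSVertex H S) :
    vertexOp R h v g q = ∑ e ∈ F, edgeOp R h e (ghostOp R h e g) q := by
  by_cases hq : q.src = v
  swap
  · rw [vertexOp_of_ne g hq]
    refine (Finset.sum_eq_zero fun e he => edgeOp_of_ne _ ?_).symm
    rwa [(hF e).1 he]
  rw [vertexOp_of_eq g hq]
  induction q using cons_induction with
  | ofH w =>
    obtain ⟨w, hw⟩ := w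
    obtain rfl : w = v := hq
    let i : {e // e ∈ F} ↪ E.HSEdge H S :=
      ⟨fun e => .ofH e.1 ((hF _).1 e.2 ▸ hw), fun e f hef => Subtype.ext (HSEdge.ofH.inj hef)⟩
    have hck := (isLeavittFamily R (E.hsGraph H S h.hereditary)).ck2 (ofH ⟨w, hw⟩) (F.attach.map i)
      (by
        intro ε
        rw [Finset.mem_map]
        constructor
        · rintro ⟨e, -, rfl⟩
          exact congrArg ofH (Subtype.ext ((hF _).1 e.2))
        · intro hε
          cases ε with
          | ofH e hs =>
            have he : E.s e = w := congrArg Subtype.val (ofH.inj hε)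
            exact ⟨⟨e, (hF e).2 he⟩, Finset.mem_attach _ _, rfl⟩
          | _ => cases hε)
      (by simpa using hne)
    rw [base, hck, Finset.sum_map, Finset.sum_mul, ← Finset.sum_attach F]
    refine Finset.sum_congr rfl fun e _ => ?_
    have he := (hF _).1 e.2
    have hs : E.s e ∈ H := he ▸ hw
    rw [edgeOp_ghostOp_of_step g (.ofH ⟨_, h.hereditary e hs⟩ ⟨w, hw⟩ rfl he), coef_ofH R h hs,
      star_edge]
    rfl
  | ofS w =>
    have hw : {e | E.s e = v}.Infinite := hq ▸ (h.subset w.2).2.1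
    exact absurd (F.finite_toSet.subset fun e he => Finset.mem_coe.2 ((hF e).2 he)) hw
  | cons e p q hc _ =>
    exact (sum_edgeOp_ghostOp_of_cons g hc ((hF e).2 (hc.src_right.symm.trans hq))).symm

/-- Everything is checked one coordinate at a time. Because `Step e` is a partial injection, a
coordinate of a composite has at most one contribution, and the relations reduce to those of the
coefficients. -/
theorem isLeavittFamily_ops (h : E.IsAdmissiblePair H S) :
    E.IsLeavittFamily (vertexOp R h) (edgeOp R h) (ghostOp R h) where
  idem v := by
    ext1 g; funext p
    rw [Module.End.mul_apply]
    by_cases hp : p.src = v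
    · rw [vertexOp_of_eq _ hp, vertexOp_of_eq _ hp, ← mul_assoc, vertex_mul_self]
    · rw [vertexOp_of_ne _ hp, vertexOp_of_ne _ hp]
  orth v w hvw := by
    ext1 g; funext p
    rw [Module.End.mul_apply]
    by_cases hp : p.src = v
    · rw [vertexOp_of_eq _ hp, vertexOp_of_ne _ (hp ▸ hvw), mul_zero]; rfl
    · rw [vertexOp_of_ne _ hp]; rfl
  source_edge e := by
    ext1 g; funext q
    rw [Module.End.mul_apply]
    by_cases hq : ∃ p, Step e p q
    · obtain ⟨p, hc⟩ := hq
      rw [vertexOp_of_eq _ hc.src_right, edgeOp_of_step _ hc, ← mul_assoc, vertex_mul_coef hc]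
    · rw [edgeOp_of_forall_not _ (not_exists.1 hq)]
      by_cases hs : q.src = E.s e
      · rw [vertexOp_of_eq _ hs, edgeOp_of_forall_not _ (not_exists.1 hq), mul_zero]
      · rw [vertexOp_of_ne _ hs]
  edge_range e := by
    ext1 g; funext q
    rw [Module.End.mul_apply]
    by_cases hq : ∃ p, Step e p q
    · obtain ⟨p, hc⟩ := hq
      rw [edgeOp_of_step _ hc, vertexOp_of_eq _ hc.src_left, edgeOp_of_step _ hc, ← mul_assoc,
        coef_mul_vertex hc]
    · rw [edgeOp_of_forall_not _ (not_exists.1 hq), edgeOp_of_forall_not _ (not_exists.1 hq)]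
  range_ghost e := by
    ext1 g; funext p
    rw [Module.End.mul_apply]
    by_cases hp : p.src = E.r e
    · obtain ⟨q, hc⟩ := exists_step_of_src h hp
      rw [vertexOp_of_eq _ hp, ghostOp_of_step _ hc, ← mul_assoc, vertex_mul_star_coef hc]
    · rw [vertexOp_of_ne _ hp, ghostOp_of_ne _ hp]
  ghost_source e := by
    ext1 g; funext p
    rw [Module.End.mul_apply]
    by_cases hp : p.src = E.r e
    · obtain ⟨q, hc⟩ := exists_step_of_src h hp
      rw [ghostOp_of_step _ hc, ghostOp_of_step _ hc, vertexOp_of_eq _ hc.src_right, ← mul_assoc,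
        star_coef_mul_vertex hc]
    · rw [ghostOp_of_ne _ hp, ghostOp_of_ne _ hp]
  ck1_same e := by
    ext1 g; funext p
    rw [Module.End.mul_apply]
    by_cases hp : p.src = E.r e
    · obtain ⟨q, hc⟩ := exists_step_of_src h hp
      rw [ghostOp_of_step _ hc, edgeOp_of_step _ hc, vertexOp_of_eq _ hp, ← mul_assoc,
        star_coef_mul_coef hc]
    · rw [ghostOp_of_ne _ hp, vertexOp_of_ne _ hp]
  ck1_ne e f hef := by
    ext1 g; funext p
    rw [Module.End.mul_apply]
    by_cases hp : p.src = E.r e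
    · obtain ⟨q, hc⟩ := exists_step_of_src h hp
      rw [ghostOp_of_step _ hc]
      by_cases hq : ∃ p, Step f p q
      · obtain ⟨p', hc'⟩ := hq
        rw [edgeOp_of_step _ hc', ← mul_assoc, star_coef_mul_coef_of_ne hef hc hc', zero_mul]; rfl
      · rw [edgeOp_of_forall_not _ (not_exists.1 hq), mul_zero]; rfl
    · rw [ghostOp_of_ne _ hp]; rfl
  ck2 v F hF hne := by
    ext1 g; funext q
    rw [vertexOp_eq_sum g hF hne, LinearMap.sum_apply, Finset.sum_apply]
    rfl

/-- The representation of `L_R(E)` on functions from the vertices of `_HE_S` to `L_R(_HE_S)`. -/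
noncomputable def hsRep (R : Type*) [CommRing R] (h : E.IsAdmissiblePair H S) :
    LeavittPathAlgebra R E →ₙₐ[R] Module.End R (HSModule R h) :=
  (existsUnique_hom (isLeavittFamily_ops h)).choose

theorem hsRep_vertex (h : E.IsAdmissiblePair H S) (v : V) :
    hsRep R h (vertex R E v) = vertexOp R h v :=
  (existsUnique_hom (isLeavittFamily_ops h)).choose_spec.1.1 v

theorem hsRep_edge (h : E.IsAdmissiblePair H S) (e : W) :
    hsRep R h (edge R E e) = edgeOp R h e :=
  (existsUnique_hom (isLeavittFamily_ops h)).choose_spec.1.2.1 e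

theorem hsRep_ghost (h : E.IsAdmissiblePair H S) (e : W) :
    hsRep R h (ghost R E e) = ghostOp R h e :=
  (existsUnique_hom (isLeavittFamily_ops h)).choose_spec.1.2.2 e

/-! ### Coordinates and injectivity of the homomorphism -/

/-- The function of coordinates of an element of `L_R(_HE_S)`. -/
noncomputable def coords (h : E.IsAdmissiblePair H S)
    (a : LeavittPathAlgebra R (E.hsGraph H S h.hereditary)) : HSModule R h :=
  fun p => star (arrow R h p) * a

theorem coords_arrow_mul_self (a : LeavittPathAlgebra R (E.hsGraph H S h.hereditary)) :
    coords h (arrow R h p * a) p = vertex R _ p.base * a := by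
  rw [coords, ← mul_assoc, star_arrow_mul_arrow_self]

theorem coords_arrow_mul_of_ne (hpq : p ≠ q)
    (a : LeavittPathAlgebra R (E.hsGraph H S h.hereditary)) :
    coords h (arrow R h q * a) p = 0 := by
  rw [coords, ← mul_assoc, star_arrow_mul_arrow_of_ne hpq, zero_mul]

theorem coords_add (a b : LeavittPathAlgebra R (E.hsGraph H S h.hereditary)) :
    coords h (a + b) = coords h a + coords h b := funext fun _ => mul_add _ _ _

theorem coords_zero : coords h (0 : LeavittPathAlgebra R (E.hsGraph H S h.hereditary)) = 0 :=
  funext fun _ => mul_zero _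

theorem coords_smul (k : R) (a : LeavittPathAlgebra R (E.hsGraph H S h.hereditary)) :
    coords h (k • a) = k • coords h a := funext fun _ => mul_smul_comm _ _ _

/-- The coordinates determine a, since each pa is `arrow p` times the coordinate at p. Only this
injectivity is needed, so the functions in the module need no finite support. -/
theorem eq_zero_of_coords {a : LeavittPathAlgebra R (E.hsGraph H S h.hereditary)}
    (ha : coords h a = 0) : a = 0 := by
  refine eq_zero_of_vertex_mul fun p => ?_
  have hp : star (arrow R h p) * a = 0 := congrFun ha p
  rw [← arrow_mul_star_arrow (h := h), mul_assoc, hp, mul_zero]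

theorem edgeOp_coords (hc : Step e p q)
    (a : LeavittPathAlgebra R (E.hsGraph H S h.hereditary)) :
    edgeOp R h e (coords h (arrow R h p * a)) = coords h (arrow R h q * (coef R h e p q * a)) := by
  funext q'
  by_cases hq : q' = q
  · subst hq
    rw [edgeOp_of_step _ hc, coords_arrow_mul_self, coords_arrow_mul_self, ← mul_assoc,
      coef_mul_vertex hc, ← mul_assoc, vertex_mul_coef hc]
  · rw [coords_arrow_mul_of_ne hq]
    by_cases hq' : ∃ p', Step e p' q'
    · obtain ⟨p', hc'⟩ := hq'
      rw [edgeOp_of_step _ hc', coords_arrow_mul_of_ne, mul_zero]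
      rintro rfl
      exact hq (hc'.right_unique h hc)
    · exact edgeOp_of_forall_not _ (not_exists.1 hq')

theorem ghostOp_coords (hc : Step e p q)
    (a : LeavittPathAlgebra R (E.hsGraph H S h.hereditary)) :
    ghostOp R h e (coords h (arrow R h q * a)) =
      coords h (arrow R h p * (star (coef R h e p q) * a)) := by
  funext p'
  by_cases hp : p' = p
  · subst hp
    rw [ghostOp_of_step _ hc, coords_arrow_mul_self, coords_arrow_mul_self, ← mul_assoc,
      star_coef_mul_vertex hc, ← mul_assoc, vertex_mul_star_coef hc]
  · rw [coords_arrow_mul_of_ne hp]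
    by_cases hp' : p'.src = E.r e
    · obtain ⟨q', hc'⟩ := exists_step_of_src h hp'
      rw [ghostOp_of_step _ hc', coords_arrow_mul_of_ne, mul_zero]
      rintro rfl
      exact hp (hc'.left_unique hc)
    · exact ghostOp_of_ne _ hp'

/-- The only vertex of _HE_S that starts at v ∈ H is v itself, so v acts as the projection to one
coordinate. -/
theorem vertexOp_coords (v : H)
    (a : LeavittPathAlgebra R (E.hsGraph H S h.hereditary)) :
    vertexOp R h v (coords h a) = coords h (arrow R h (ofH v) * a) := by
  funext p
  by_cases hp : p.src = v
  · obtain rfl : p = ofH v := eq_ofH_of_src_mem h hp v.2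
    rw [vertexOp_of_eq _ hp, coords_arrow_mul_self]
    simp only [coords, arrow, star_vertex, base, ← mul_assoc, vertex_mul_self]
  · rw [vertexOp_of_ne _ hp, coords_arrow_mul_of_ne]
    rintro rfl
    exact hp rfl

/-- The operator of v ∈ S keeps the coordinates of v and of all paths from v. Such a path begins
with an edge that ends outside H, so subtracting the corresponding e e^* removes every path and
leaves the coordinate of v. -/
theorem hsRep_breakingElement_coords (v : S)
    (a : LeavittPathAlgebra R (E.hsGraph H S h.hereditary)) :
    hsRep R h (E.breakingElement R H v) (coords h a) = coords h (arrow R h (ofS v) * a) := by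
  have hsum : ∀ p, hsRep R h (E.breakingElement R H v) (coords h a) p =
      vertexOp R h v (coords h a) p - ∑ e ∈ (h.finite_range_notMem v.2).toFinset,
        edgeOp R h e (ghostOp R h e (coords h a)) p := by
    intro p
    rw [breakingElement_eq h v.2, map_sub, map_sum, hsRep_vertex, LinearMap.sub_apply,
      Pi.sub_apply, LinearMap.sum_apply, Finset.sum_apply]
    congr 1
    refine Finset.sum_congr rfl fun e _ => ?_
    rw [map_mul, hsRep_edge, hsRep_ghost, Module.End.mul_apply]
  have hF : ∀ e, e ∈ (h.finite_range_notMem v.2).toFinset ↔ E.s e = v ∧ E.r e ∉ H := by simp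
  funext p
  rw [hsum]
  by_cases hp : p.src = v
  swap
  · rw [vertexOp_of_ne _ hp, coords_arrow_mul_of_ne, Finset.sum_eq_zero, sub_zero]
    · intro e he
      refine edgeOp_of_ne _ ?_
      rwa [((hF e).1 he).1]
    · rintro rfl
      exact hp rfl
  rw [vertexOp_of_eq _ hp]
  induction p using cons_induction with
  | ofH w => exact absurd (hp ▸ w.2) (h.notMem_left v.2)
  | ofS w =>
    obtain rfl : w = v := Subtype.ext hp
    rw [coords_arrow_mul_self, Finset.sum_eq_zero, sub_zero]
    · simp only [coords, arrow, star_vertex, base, ← mul_assoc, vertex_mul_self]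
    · intro e he
      refine edgeOp_of_forall_not _ fun p hc => ?_
      cases hc with
      | ofS u _ hu _ => exact ((hF e).1 he).2 (hu ▸ u.2)
      | cons hc => cases hc
  | cons e p q hc _ =>
    have hs : E.s e = v := hc.src_right.symm.trans hp
    rw [sum_edgeOp_ghostOp_of_cons _ hc ((hF e).2 ⟨hs, hc.range_notMem h (hs ▸ v.2)⟩), sub_self,
      coords_arrow_mul_of_ne]
    rintro rfl
    cases hc

theorem hsRep_toLPA_coords (p : E.HSVertex H S)
    (a : LeavittPathAlgebra R (E.hsGraph H S h.hereditary)) :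
    hsRep R h (p.toLPA R) (coords h a) = coords h (arrow R h p * a) := by
  induction p using cons_induction with
  | ofH v => rw [toLPA, hsRep_vertex, vertexOp_coords]
  | ofS v => exact hsRep_breakingElement_coords v a
  | cons e p q hc ih =>
    rw [toLPA_cons hc, map_mul, Module.End.mul_apply, ih, hsRep_edge, edgeOp_coords (.cons hc),
      coef_cons hc, ← hc.base_eq, ← mul_assoc, arrow_mul_vertex]

theorem hsRep_star_toLPA_coords (p : E.HSVertex H S)
    (a : LeavittPathAlgebra R (E.hsGraph H S h.hereditary)) :
    hsRep R h (star (p.toLPA R)) (coords h a) = coords h (star (arrow R h p) * a) := by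
  induction a using induction_vertex_mul with
  | zero => rw [mul_zero, coords_zero, map_zero]
  | add a b ha hb => rw [mul_add, coords_add, coords_add, map_add, ha, hb]
  | hv q a =>
    -- Coordinates of elements starting with `arrow q` come from the action of t_q, so the
    -- orthogonality of t_p and t_q in L_R(E) decides the product.
    rw [← arrow_mul_star_arrow (h := h), mul_assoc, ← hsRep_toLPA_coords, ← Module.End.mul_apply, ← map_mul]
    by_cases hpq : p = q
    · subst hpq
      rw [star_toLPA_mul_toLPA_self h, hsRep_toLPA_coords, arrow_base,
        ← mul_assoc _ (arrow R h p), star_arrow_mul_arrow_self]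
    · rw [star_toLPA_mul_toLPA_of_ne h hpq, ← mul_assoc _ (arrow R h q),
        star_arrow_mul_arrow_of_ne hpq, map_zero, zero_mul, coords_zero, LinearMap.zero_apply]

theorem hsRep_edge_coords {v w : E.HSVertex H S} (hc : Step e v w)
    (hw : w.base = w) (a : LeavittPathAlgebra R (E.hsGraph H S h.hereditary)) :
    hsRep R h (edge R E e * v.toLPA R) (coords h a) = coords h (coef R h e v w * a) := by
  rw [map_mul, Module.End.mul_apply, hsRep_toLPA_coords, hsRep_edge, edgeOp_coords hc, ← hw,
    arrow_base, hw, ← mul_assoc]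
  nth_rw 1 [← hw]
  rw [vertex_mul_coef hc]

theorem hsRep_ghost_coords {v w : E.HSVertex H S} (hc : Step e v w) (hv : v.base = v)
    (a : LeavittPathAlgebra R (E.hsGraph H S h.hereditary)) :
    hsRep R h (ghost R E e * w.toLPA R) (coords h a) = coords h (star (coef R h e v w) * a) := by
  rw [map_mul, Module.End.mul_apply, hsRep_toLPA_coords, hsRep_ghost, ghostOp_coords hc, ← hv,
    arrow_base, hv, ← mul_assoc]
  nth_rw 1 [← hv]
  rw [vertex_mul_star_coef hc]

/-- The representation undoes `hsHom`: in coordinates, the image of x acts as left multiplication by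
x. It suffices to see this on the generators. -/
theorem hsRep_hsHom_coords (x a : LeavittPathAlgebra R (E.hsGraph H S h.hereditary)) :
    hsRep R h (hsHom R h x) (coords h a) = coords h (x * a) := by
  induction x using LeavittPathAlgebra.induction generalizing a with
  | hv p =>
    rw [hsHom_vertex, map_mul, Module.End.mul_apply, hsRep_star_toLPA_coords, hsRep_toLPA_coords,
      ← mul_assoc, arrow_mul_star_arrow]
  | he ε =>
    rw [hsHom_edge]
    cases ε with
    | ofH e hs =>
      have := hsRep_edge_coords (R := R) (h := h)
        (.ofH ⟨_, h.hereditary e hs⟩ ⟨_, hs⟩ rfl rfl) rfl a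
      rw [coef_ofH R h hs, toLPA, edge_mul_vertex] at this
      exact this
    | ofS e hs hr =>
      have := hsRep_edge_coords (R := R) (h := h) (.ofS ⟨_, hr⟩ ⟨_, hs⟩ rfl rfl) rfl a
      rw [coef_ofS R h hs hr, toLPA, edge_mul_vertex] at this
      exact this
    | bar₁ α => exact hsRep_toLPA_coords (ofF₁ α) a
    | bar₂ α => exact hsRep_toLPA_coords (ofF₂ α) a
  | hg ε =>
    rw [hsHom_ghost]
    cases ε with
    | ofH e hs =>
      have := hsRep_ghost_coords (R := R) (h := h)
        (.ofH ⟨_, h.hereditary e hs⟩ ⟨_, hs⟩ rfl rfl) rfl a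
      rw [coef_ofH R h hs, toLPA, ghost_mul_vertex, star_edge] at this
      rw [HSEdge.toLPA, star_edge]
      exact this
    | ofS e hs hr =>
      have := hsRep_ghost_coords (R := R) (h := h) (.ofS ⟨_, hr⟩ ⟨_, hs⟩ rfl rfl) rfl a
      have hm : ghost R E e * E.breakingElement R H (E.s e) = ghost R E e := by
        simpa [star_breakingElement h hs] using
          congrArg star (breakingElement_mul_edge_of_mem (R := R) h hs hr)
      rw [coef_ofS R h hs hr, toLPA, hm, star_edge] at this
      rw [HSEdge.toLPA, star_edge]
      exact this
    | bar₁ α =>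
      have := hsRep_star_toLPA_coords (h := h) (ofF₁ α) a
      rwa [arrow, star_edge] at this
    | bar₂ α =>
      have := hsRep_star_toLPA_coords (h := h) (ofF₂ α) a
      rwa [arrow, star_edge] at this
  | zero => rw [map_zero, map_zero, zero_mul, coords_zero, LinearMap.zero_apply]
  | add x y hx hy => rw [map_add, map_add, LinearMap.add_apply, hx, hy, add_mul, coords_add]
  | mul x y hx hy => rw [map_mul, map_mul, Module.End.mul_apply, hy, hx, mul_assoc]
  | smul k x hx =>
    rw [map_smul, map_smul, LinearMap.smul_apply, hx, smul_mul_assoc, coords_smul]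

theorem hsHom_injective (h : E.IsAdmissiblePair H S) : Function.Injective (hsHom R h) := by
  refine (injective_iff_map_eq_zero _).2 fun x hx => ?_
  refine eq_zero_of_mul_right fun a => eq_zero_of_coords (h := h) ?_
  rw [← hsRep_hsHom_coords, hx, map_zero, LinearMap.zero_apply]

/-- The isomorphism `L_R(_HE_S) ≃ I(H, S)`. -/
noncomputable def hsEquiv (R : Type*) [CommRing R] (h : E.IsAdmissiblePair H S) :
    LeavittPathAlgebra R (E.hsGraph H S h.hereditary) ≃+* E.idealOf R H S :=
  RingEquiv.ofBijective
    ({ toFun := fun x => ⟨hsHom R h x, hsHom_mem_idealOf h x⟩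
       map_mul' := fun x y => Subtype.ext (map_mul (hsHom R h) x y)
       map_zero' := Subtype.ext (map_zero (hsHom R h))
       map_add' := fun x y => Subtype.ext (map_add (hsHom R h) x y) } :
      LeavittPathAlgebra R (E.hsGraph H S h.hereditary) →ₙ+* E.idealOf R H S)
    ⟨fun _ _ hxy => hsHom_injective h (congrArg Subtype.val hxy), fun y =>
      let ⟨z, hz⟩ := exists_hsHom_eq_of_mem h y.2
      ⟨z, Subtype.ext hz⟩⟩

end DirGraph

theorem proposition3p13 {V W R : Type*} [Countable V] [Countable W] [CommRing R]
    (E : DirGraph V W) (H S : Set V) (h : E.IsAdmissiblePair H S) :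
    Nonempty (E.idealOf R H S ≃+* LeavittPathAlgebra R (E.hsGraph H S h.hereditary)) ∧
      ∃ U : Set (E.idealOf R H S), IsSetOfLocalUnits U :=
  ⟨⟨(DirGraph.hsEquiv R h).symm⟩, _,
    LeavittPathAlgebra.isSetOfLocalUnits_range_sum_vertex.image (DirGraph.hsEquiv R h)⟩
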